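/- Let $k$ be a field and let $Q$ be a quiver with finitely many vertices and finitely many arrows. Let $kQ$ be its path algebra: the $k$-algebra with basis all paths of $Q$ (including the trivial path at each vertex), where the product $pq$ of two paths is their concatenation ($p$ first, then $q$) if $p$ ends where $q$ starts, and $0$ otherwise; it is $\mathbb{N}$-graded by path length. Let $\operatorname{Gr} kQ$ be the category of $\mathbb{Z}$-graded right $kQ$-modules with degree-preserving homomorphisms, let $\operatorname{Tors} kQ$ be its full subcategory of torsion modules (those $M$ such that for every $m \in M$ there is an $n$ with $m\,(kQ)_{\ge n} = 0$), and let $\operatorname{QGr} kQ = \operatorname{Gr} kQ/\operatorname{Tors} kQ$ be the quotient category. A vertex of $Q$ is called cyclic if it lies on some cycle, i.e. on a closed path of positive length in which no arrow is repeated. Suppose that $kQ$ is left Noetherian or right Noetherian. Then: (i) if $kQ$ is infinite-dimensional over $k$, then its Gelfand--Kirillov dimension is $$\operatorname{GKdim} kQ = \sup_W \limsup_{n\to\infty} \frac{\log \dim_k (k + W + W^2 + \cdots + W^n)}{\log n} = 1,$$ where $W$ runs over the finite-dimensional subspaces of $kQ$; (ii) there is an equivalence of categories $$\operatorname{QGr}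 kQ \simeq \operatorname{Mod} k^n,$$ where $n$ is the number of cyclic vertices of $Q$ and $\operatorname{Mod} k^n$ is the category of modules over the product ring $k^n$ (for $n = 0$, the zero ring). -/

import Mathlib

universe u v e w

open CategoryTheory

/-! ### Cycles in quivers -/

/-- The list of arrows `a₁, …, aₘ` of a path, each arrow being recorded with its endpoints. -/
def Quiver.Path.arrows {V : Type v} [Quiver.{e} V] {a : V} :
    {b : V} → Quiver.Path a b → List (Σ x y : V, x ⟶ y)
  | _, .nil => []
  | _, .cons p f => p.arrows ++ [⟨_, _, f⟩]

/-- A closed path (of positive length) is a cycle if no arrow is repeated in it. -/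
def Quiver.Path.IsCycle {V : Type v} [Quiver.{e} V] {a : V} (p : Quiver.Path a a) : Prop :=
  0 < p.length ∧ p.arrows.Nodup

/-- A vertex is cyclic if it is part of some cycle. -/
def IsCyclicVertex {V : Type v} [Quiver.{e} V] (x : V) : Prop :=
  ∃ (a : V) (p : Quiver.Path a a), p.IsCycle ∧ x ∈ p.vertices

/-! ### Path algebras -/

/-- All paths of a quiver, including the trivial ones: triples (source, target, path). -/
abbrev QuiverPath (V : Type v) [Quiver.{e} V] : Type (max v e) :=
  Σ a b : V, Quiver.Path a b

/-- The path algebra: the vector space with basis the paths of the quiver. -/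
def PathAlgebra (k : Type u) [Field k] (V : Type v) [Quiver.{e} V] : Type (max u v e) :=
  QuiverPath V →₀ k

namespace PathAlgebra

noncomputable section

variable {k : Type u} [Field k] {V : Type v} [Quiver.{e} V]

instance : AddCommGroup (PathAlgebra k V) := inferInstanceAs (AddCommGroup (QuiverPath V →₀ k))

instance : Module k (PathAlgebra k V) := inferInstanceAs (Module k (QuiverPath V →₀ k))

/-- The basis element given by a path. -/
def ofPath (k : Type u) [Field k] (p : QuiverPath V) : PathAlgebra k V :=
  (Finsupp.single p 1 : QuiverPath V →₀ k)

open Classical in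
/-- The product of two paths: their concatenation if the target of the first is the source of
the second, and zero otherwise. -/
def pathMul (k : Type u) [Field k] (p q : QuiverPath V) : PathAlgebra k V :=
  if h : p.2.1 = q.1 then ofPath k ⟨p.1, q.2.1, (p.2.2.cast rfl h).comp q.2.2⟩ else 0

/-- The linear extension of a map defined on paths. -/
def lift {M : Type*} [AddCommGroup M] [Module k M] (f : QuiverPath V → M) :
    PathAlgebra k V →ₗ[k] M :=
  Finsupp.linearCombination k f

/-- The multiplication of the path algebra, as a bilinear map. -/
def mulHom : PathAlgebra k V →ₗ[k] PathAlgebra k V →ₗ[k] PathAlgebra k V :=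
  lift fun p => lift fun q => pathMul k p q

instance : Mul (PathAlgebra k V) := ⟨fun x y => mulHom x y⟩

instance [Fintype V] : One (PathAlgebra k V) :=
  ⟨∑ a : V, ofPath k ⟨a, a, Quiver.Path.nil⟩⟩

theorem mul_def (x y : PathAlgebra k V) : x * y = mulHom x y := rfl

theorem one_def [Fintype V] :
    (1 : PathAlgebra k V) = ∑ a : V, ofPath k ⟨a, a, Quiver.Path.nil⟩ := rfl

@[simp]
theorem lift_ofPath {M : Type*} [AddCommGroup M] [Module k M] (f : QuiverPath V → M)
    (p : QuiverPath V) : lift f (ofPath k p) = f p := by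
  exact (Finsupp.linearCombination_single k 1 p).trans (one_smul k (f p))

theorem induction_on {P : PathAlgebra k V → Prop} (x : PathAlgebra k V) (zero : P 0)
    (add : ∀ x y, P x → P y → P (x + y)) (smul : ∀ (c : k) p, P (c • ofPath k p)) : P x := by
  refine Finsupp.induction_linear (motive := P) x zero add fun p c => ?_
  have h := smul c p
  have h2 : c • ofPath k p = (Finsupp.single p c : QuiverPath V →₀ k) := by
    change c • (Finsupp.single p 1 : QuiverPath V →₀ k) = _
    rw [Finsupp.smul_single, smul_eq_mul, mul_one]
  rwa [h2] at h

theorem ofPath_mul_ofPath (p q : QuiverPath V) :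
    ofPath k p * ofPath k q = pathMul k p q := by
  simp [mul_def, mulHom]

theorem ofPath_mul_ofPath_of_eq {a b c : V} (p : Quiver.Path a b) (q : Quiver.Path b c) :
    ofPath k ⟨a, b, p⟩ * ofPath k ⟨b, c, q⟩ = ofPath k ⟨a, c, p.comp q⟩ := by
  simp [ofPath_mul_ofPath, pathMul]

theorem ofPath_mul_ofPath_of_ne {a b b' c : V} (p : Quiver.Path a b) (q : Quiver.Path b' c)
    (h : b ≠ b') : ofPath k ⟨a, b, p⟩ * ofPath k ⟨b', c, q⟩ = 0 := by
  simp [ofPath_mul_ofPath, pathMul, h]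

protected theorem add_mul' (x y z : PathAlgebra k V) : (x + y) * z = x * z + y * z := by
  simp [mul_def]

protected theorem mul_add' (x y z : PathAlgebra k V) : x * (y + z) = x * y + x * z := by
  simp [mul_def]

protected theorem zero_mul' (x : PathAlgebra k V) : 0 * x = 0 := by simp [mul_def]

protected theorem mul_zero' (x : PathAlgebra k V) : x * 0 = 0 := by simp [mul_def]

protected theorem smul_mul' (c : k) (x y : PathAlgebra k V) : (c • x) * y = c • (x * y) := by
  simp [mul_def]

protected theorem mul_smul' (c : k) (x y : PathAlgebra k V) : x * (c • y) = c • (x * y) := by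
  simp [mul_def]

theorem ofPath_mul_assoc (p q r : QuiverPath V) :
    ofPath k p * ofPath k q * ofPath k r = ofPath k p * (ofPath k q * ofPath k r) := by
  obtain ⟨a, b, p⟩ := p
  obtain ⟨c, d, q⟩ := q
  obtain ⟨f, g, r⟩ := r
  by_cases h : b = c
  · subst h
    by_cases h' : d = f
    · subst h'
      simp [ofPath_mul_ofPath_of_eq]
    · rw [ofPath_mul_ofPath_of_eq, ofPath_mul_ofPath_of_ne _ _ h', ofPath_mul_ofPath_of_ne _ _ h',
        PathAlgebra.mul_zero']
  · rw [ofPath_mul_ofPath_of_ne _ _ h, PathAlgebra.zero_mul']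
    by_cases h' : d = f
    · subst h'
      rw [ofPath_mul_ofPath_of_eq, ofPath_mul_ofPath_of_ne _ _ h]
    · rw [ofPath_mul_ofPath_of_ne _ _ h', PathAlgebra.mul_zero']

protected theorem mul_assoc' (x y z : PathAlgebra k V) : x * y * z = x * (y * z) := by
  induction x using induction_on with
  | zero => simp only [PathAlgebra.zero_mul']
  | add x x' hx hx' => simp only [PathAlgebra.add_mul', hx, hx']
  | smul c p =>
    induction y using induction_on with
    | zero => simp only [PathAlgebra.zero_mul', PathAlgebra.mul_zero']
    | add y y' hy hy' => simp only [PathAlgebra.add_mul', PathAlgebra.mul_add', hy, hy']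
    | smul d q =>
      induction z using induction_on with
      | zero => simp only [PathAlgebra.mul_zero']
      | add z z' hz hz' => simp only [PathAlgebra.mul_add', hz, hz']
      | smul f r =>
        simp only [PathAlgebra.smul_mul', PathAlgebra.mul_smul', ofPath_mul_assoc]

protected theorem one_mul' [Fintype V] (x : PathAlgebra k V) : 1 * x = x := by
  induction x using induction_on with
  | zero => exact PathAlgebra.mul_zero' _
  | add x y hx hy => rw [PathAlgebra.mul_add', hx, hy]
  | smul c p =>
    obtain ⟨a, b, p⟩ := p
    rw [PathAlgebra.mul_smul', one_def, mul_def, map_sum, LinearMap.sum_apply,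
      Finset.sum_eq_single a]
    · rw [← mul_def, ofPath_mul_ofPath_of_eq, Quiver.Path.nil_comp]
    · intro d _ hd
      rw [← mul_def, ofPath_mul_ofPath_of_ne _ _ hd]
    · simp

protected theorem mul_one' [Fintype V] (x : PathAlgebra k V) : x * 1 = x := by
  induction x using induction_on with
  | zero => exact PathAlgebra.zero_mul' _
  | add x y hx hy => rw [PathAlgebra.add_mul', hx, hy]
  | smul c p =>
    obtain ⟨a, b, p⟩ := p
    rw [PathAlgebra.smul_mul', one_def, mul_def, map_sum, Finset.sum_eq_single b]
    · rw [← mul_def, ofPath_mul_ofPath_of_eq, Quiver.Path.comp_nil]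
    · intro d _ hd
      rw [← mul_def, ofPath_mul_ofPath_of_ne _ _ hd.symm]
    · simp

instance [Fintype V] : Ring (PathAlgebra k V) where
  __ := (inferInstance : AddCommGroup (PathAlgebra k V))
  mul := (· * ·)
  one := 1
  left_distrib := PathAlgebra.mul_add'
  right_distrib := PathAlgebra.add_mul'
  zero_mul := PathAlgebra.zero_mul'
  mul_zero := PathAlgebra.mul_zero'
  mul_assoc := PathAlgebra.mul_assoc'
  one_mul := PathAlgebra.one_mul'
  mul_one := PathAlgebra.mul_one'

instance [Fintype V] : Algebra k (PathAlgebra k V) :=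
  Algebra.ofModule PathAlgebra.smul_mul' PathAlgebra.mul_smul'

variable (k V) in
/-- The grading of the path algebra by the length of paths. -/
def grading (n : ℕ) : Submodule k (PathAlgebra k V) :=
  Submodule.span k {x | ∃ p : QuiverPath V, p.2.2.length = n ∧ x = ofPath k p}

theorem ofPath_mem_grading (p : QuiverPath V) : ofPath k p ∈ grading k V p.2.2.length :=
  Submodule.subset_span ⟨p, rfl, rfl⟩

theorem mul_mem_grading [Fintype V] {i j : ℕ} {x y : PathAlgebra k V} (hx : x ∈ grading k V i)
    (hy : y ∈ grading k V j) : x * y ∈ grading k V (i + j) := by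
  induction hx using Submodule.span_induction with
  | zero => rw [zero_mul]; exact zero_mem _
  | add x x' _ _ h h' => rw [add_mul]; exact add_mem h h'
  | smul c x _ h => rw [smul_mul_assoc]; exact Submodule.smul_mem _ _ h
  | mem x hx =>
    obtain ⟨⟨a, b, p⟩, hp, rfl⟩ := hx
    induction hy using Submodule.span_induction with
    | zero => rw [mul_zero]; exact zero_mem _
    | add y y' _ _ h h' => rw [mul_add]; exact add_mem h h'
    | smul c y _ h => rw [mul_smul_comm]; exact Submodule.smul_mem _ _ h
    | mem y hy =>
      obtain ⟨⟨c, d, q⟩, hq, rfl⟩ := hy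
      by_cases h : b = c
      · subst h
        rw [ofPath_mul_ofPath_of_eq]
        refine Submodule.subset_span ⟨_, ?_, rfl⟩
        simp only [Quiver.Path.length_comp] at hp hq ⊢
        rw [hp, hq]
      · rw [ofPath_mul_ofPath_of_ne _ _ h]
        exact zero_mem _

instance [Fintype V] : SetLike.GradedMonoid (grading k V) where
  one_mem := Submodule.sum_mem _ fun _ _ => Submodule.subset_span ⟨_, rfl, rfl⟩
  mul_mem _ _ _ _ hx hy := mul_mem_grading hx hy

/-- The decomposition of an element of the path algebra into homogeneous components. -/
def decomposeHom : PathAlgebra k V →ₗ[k] DirectSum ℕ fun n => grading k V n :=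
  lift fun p => DirectSum.lof k ℕ (fun n => grading k V n) p.2.2.length
    ⟨ofPath k p, ofPath_mem_grading p⟩

theorem decomposeHom_of_mem {n : ℕ} {x : PathAlgebra k V} (hx : x ∈ grading k V n) :
    decomposeHom x = DirectSum.lof k ℕ (fun n => grading k V n) n ⟨x, hx⟩ := by
  induction hx using Submodule.span_induction with
  | zero => rw [map_zero]; exact (map_zero _).symm
  | add x y hx hy h h' => rw [map_add, h, h', ← map_add]; rfl
  | smul c x hx h => rw [map_smul, h, ← map_smul]; rfl
  | mem x hx =>
    obtain ⟨p, rfl, rfl⟩ := hx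
    simp [decomposeHom]

instance [Fintype V] : GradedAlgebra (grading k V) where
  decompose' := decomposeHom
  left_inv x := by
    induction x using induction_on with
    | zero => simp
    | add x y hx hy => rw [map_add, map_add, hx, hy]
    | smul c p =>
      rw [map_smul, decomposeHom_of_mem (ofPath_mem_grading p), ← map_smul]
      exact DirectSum.coeAddMonoidHom_of _ _ _
  right_inv x := by
    induction x using DirectSum.induction_on with
    | zero => simp
    | of n x =>
      rw [DirectSum.coeAddMonoidHom_of, decomposeHom_of_mem x.2]
      rfl
    | add x y hx hy => rw [map_add, map_add, hx, hy]

end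

end PathAlgebra

/-! ### Gelfand-Kirillov dimension -/

/-- The Gelfand-Kirillov dimension of a `k`-algebra: the supremum, over all finite-dimensional
subspaces `W`, of `limsup log (dim (k + W + W ^ 2 + ⋯ + W ^ n)) / log n`. -/
noncomputable def gkDim (k : Type u) [Field k] (A : Type v) [Ring A] [Algebra k A] : EReal :=
  ⨆ W : {W : Submodule k A // W.FG},
    Filter.limsup
      (fun n : ℕ =>
        ((Real.log (Module.finrank k (⨆ i : Fin (n + 1), W.1 ^ (i : ℕ) : Submodule k A)) /
          Real.log n : ℝ) : EReal))
      Filter.atTop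

/-! ### Graded right modules and the quotient category -/

section QGr

variable {k : Type u} [Field k] {A : Type v} [Ring A] [Algebra k A]

/-- A right `A`-module `M` is torsion if for every `m` in `M` one has `m A_{≥ n} = 0`
for some `n`. -/
def IsTorsionModule (𝒜 : ℕ → Submodule k A) (M : Type*) [AddCommGroup M] [Module Aᵐᵒᵖ M] : Prop :=
  ∀ m : M, ∃ n : ℕ, ∀ i, n ≤ i → ∀ a ∈ 𝒜 i, MulOpposite.op a • m = 0

/-- A `ℤ`-graded right module over an `ℕ`-graded algebra `A`; right `A`-modules are modules over
the opposite ring. -/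
structure GrModule (𝒜 : ℕ → Submodule k A) [GradedAlgebra 𝒜] where
  carrier : Type w
  [addCommGroup : AddCommGroup carrier]
  [module : Module Aᵐᵒᵖ carrier]
  /-- the homogeneous components -/
  deg : ℤ → AddSubgroup carrier
  isInternal : DirectSum.IsInternal deg
  smul_mem : ∀ {i : ℕ} {j : ℤ} {a : A} {m : carrier}, a ∈ 𝒜 i → m ∈ deg j →
    MulOpposite.op a • m ∈ deg (j + i)

attribute [instance] GrModule.addCommGroup GrModule.module

variable {𝒜 : ℕ → Submodule k A} [GradedAlgebra 𝒜]

/-- Degree-preserving homomorphisms of graded right modules. -/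
@[ext]
structure GrModule.Hom (M N : GrModule.{u, v, w} 𝒜) where
  toLinearMap : M.carrier →ₗ[Aᵐᵒᵖ] N.carrier
  map_deg : ∀ (j : ℤ) (m : M.carrier), m ∈ M.deg j → toLinearMap m ∈ N.deg j

/-- The category `Gr A`. -/
instance : Category (GrModule.{u, v, w} 𝒜) where
  Hom := GrModule.Hom
  id M := ⟨LinearMap.id, fun _ _ h => h⟩
  comp f g := ⟨g.toLinearMap.comp f.toLinearMap, fun _ _ h => g.map_deg _ _ (f.map_deg _ _ h)⟩

variable (𝒜) in
/-- The morphisms of `Gr A` whose kernel and cokernel are torsion. -/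
def torsionIso : MorphismProperty (GrModule.{u, v, w} 𝒜) := fun _ N f =>
  IsTorsionModule 𝒜 (LinearMap.ker (GrModule.Hom.toLinearMap f)) ∧
    IsTorsionModule 𝒜 (N.carrier ⧸ LinearMap.range (GrModule.Hom.toLinearMap f))

variable (𝒜) in
/-- The quotient category `QGr A = Gr A / Tors A`: the localization of `Gr A` at the morphisms
with torsion kernel and torsion cokernel. -/
abbrev QGr : Type (max v (w + 1)) := (torsionIso.{u, v, w} 𝒜).Localization

end QGr

/-! ### Closed paths and cyclic vertices -/

section Combinatorics

variable {V : Type v} [Quiver.{e} V]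

namespace Quiver.Path

/-! The Noetherian hypothesis enters only through the shape of the quiver. Let `p` be a closed path
of positive length at `c` and `f` an arrow leaving `c`. In the right Noetherian case the chain of
right ideals generated by `f, pf, ..., pⁿf` stabilises, so some `pⁿ⁺¹f` starts with `pⁱf` for an `i
≤ n`, and `f` must be the first arrow of `p`. Hence a cyclic vertex has a single outgoing arrow; in
the left Noetherian case it has a single incoming one. Both cases yield `HasIsolatedCycles`, from
which everything else follows: passing to the next cyclic vertex is a permutation `σ`, and if `x`
(`cycleElt`) is the sum of the arrows `c → σ c`, then a path of length `n` between cyclic vertices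
is `e_a xⁿ`, with `e_a` the trivial path at its source.

Growth. A path with at least `N = |V|` arrows meets a cyclic vertex. Cutting `N` arrows off both
ends of a path of length `n ≥ 2N` leaves a path between cyclic vertices, so `A_n ⊆ A_N x^(n-2N)
A_N`: the dimensions of the `A_n` are bounded and growth is at most linear. If the algebra is
infinite-dimensional, there are paths of every length, and growth is at least linear.

Quotient category. Up to torsion only high degrees count, and there `x` governs the module. Let `F
M` be the colimit of the components `M_j` along `x`, realised as `M / {m - m x}`. Since `e_c x = x
e_(σ c)`, functions on the cyclic vertices act on it once their action in degree `j` is twisted by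
`σ^(-j)`. Conversely `G N = N[ℤ]`, where `x` shifts the degree and paths with a non-cyclic end act
by zero. Then `F G ≅ 1`, while `M` and `G F M` are joined by a natural zigzag `M ← core M → G F M`
whose two maps have torsion kernel and cokernel (`torsionIso_coreIncl`,
`torsionIso_coreToPeriodic`). The core discards the vertices that are not cyclic but lead to a
cyclic one; without this the second map would not be linear. As `F` inverts such maps,
`nonempty_localization_equivalence` concludes. -/

@[simp]
theorem arrows_nil {a : V} : (nil : Path a a).arrows = [] := rfl

@[simp]
theorem arrows_cons {a b c : V} (p : Path a b) (f : b ⟶ c) :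
    (p.cons f).arrows = p.arrows ++ [⟨b, c, f⟩] := rfl

theorem arrows_comp {a b c : V} (p : Path a b) (q : Path b c) :
    (p.comp q).arrows = p.arrows ++ q.arrows := by
  induction q with
  | nil => simp
  | cons q f ih => simp [ih]

theorem length_arrows {a b : V} (p : Path a b) : p.arrows.length = p.length := by
  induction p with
  | nil => rfl
  | cons p f ih => simp [ih]

theorem exists_eq_cons_comp_of_mem_arrows {a b x y : V} {f : x ⟶ y} (p : Path a b)
    (h : (⟨x, y, f⟩ : Σ x y : V, x ⟶ y) ∈ p.arrows) :
    ∃ (q : Path a x) (r : Path y b), p = (q.cons f).comp r := by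
  induction p with
  | nil => simp at h
  | cons p g ih =>
    rw [arrows_cons, List.mem_append, List.mem_singleton] at h
    rcases h with h | h
    · obtain ⟨q, r, rfl⟩ := ih h
      exact ⟨q, r.cons g, rfl⟩
    · cases h
      exact ⟨p, nil, rfl⟩

/-- Every path can be shortened to one without repeated arrows. -/
theorem exists_nodup_arrows {a b : V} (p : Path a b) :
    ∃ q : Path a b, q.arrows.Nodup ∧ (0 < p.length → 0 < q.length) := by
  induction p with
  | nil => exact ⟨nil, by simp, id⟩
  | @cons c d p g ih =>
    obtain ⟨q, hq, -⟩ := ih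
    by_cases h : (⟨c, d, g⟩ : Σ x y : V, x ⟶ y) ∈ q.arrows
    · obtain ⟨q₁, q₂, rfl⟩ := exists_eq_cons_comp_of_mem_arrows q h
      rw [arrows_comp] at hq
      -- The earlier occurrence of `g` already ends at the target, so everything after it is
      -- dropped.
      exact ⟨q₁.cons g, hq.of_append_left, fun _ => Nat.succ_pos _⟩
    · refine ⟨q.cons g, ?_, fun _ => Nat.succ_pos _⟩
      rw [arrows_cons, List.nodup_append]
      refine ⟨hq, List.nodup_singleton _, ?_⟩
      rintro x hx y hy rfl
      rw [List.mem_singleton] at hy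
      exact h (hy ▸ hx)

end Quiver.Path

open Quiver (Path)

/-- A cycle can be rotated to start at any of its vertices; conversely a closed path loses its
repeated arrows without moving its endpoints. The condition on repetitions can then be forgotten. -/
theorem isCyclicVertex_iff {x : V} : IsCyclicVertex x ↔ ∃ p : Path x x, 0 < p.length := by
  constructor
  · rintro ⟨a, p, hp, hx⟩
    obtain ⟨q, r, rfl⟩ := p.exists_eq_comp_of_mem_vertices hx
    refine ⟨r.comp q, ?_⟩
    have := hp.1
    rw [Quiver.Path.length_comp] at this ⊢
    omega
  · rintro ⟨p, hp⟩
    obtain ⟨q, hq, hpos⟩ := p.exists_nodup_arrows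
    exact ⟨x, q, ⟨hpos hp, hq⟩, q.start_mem_vertices⟩

theorem IsCyclicVertex.exists_succ {x : V} (hx : IsCyclicVertex x) :
    ∃ (y : V) (_ : x ⟶ y), IsCyclicVertex y := by
  obtain ⟨p, hp⟩ := isCyclicVertex_iff.1 hx
  obtain ⟨y, f, q, -, -⟩ := p.length_ne_zero_iff_eq_comp.1 hp.ne'
  exact ⟨y, f, isCyclicVertex_iff.2 ⟨q.comp f.toPath, by simp⟩⟩

theorem IsCyclicVertex.exists_pred {x : V} (hx : IsCyclicVertex x) :
    ∃ (y : V) (_ : y ⟶ x), IsCyclicVertex y := by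
  obtain ⟨p, hp⟩ := isCyclicVertex_iff.1 hx
  cases p with
  | nil => simp at hp
  | @cons y _ q f => exact ⟨y, f, isCyclicVertex_iff.2 ⟨f.toPath.comp q, by simp⟩⟩

theorem Quiver.Path.nodup_vertices_of_forall_not_isCyclicVertex {a b : V} (p : Path a b)
    (h : ∀ x ∈ p.vertices, ¬ IsCyclicVertex x) : p.vertices.Nodup := by
  induction p with
  | nil => simp
  | @cons c d p g ih =>
    rw [vertices_cons, List.concat_eq_append] at h ⊢
    rw [List.nodup_append]
    refine ⟨ih fun x hx => h x (List.mem_append_left _ hx), List.nodup_singleton _, ?_⟩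
    rintro x hx y hy rfl
    rw [List.mem_singleton] at hy
    subst hy
    obtain ⟨q, r, rfl⟩ := p.exists_eq_comp_of_mem_vertices hx
    exact h x (by simp) (isCyclicVertex_iff.2 ⟨r.cons g, Nat.succ_pos _⟩)

/-- Pigeonhole: the path visits one more vertex than it has arrows, so some vertex is visited twice.
-/
theorem Quiver.Path.exists_isCyclicVertex [Fintype V] {a b : V} (p : Path a b)
    (h : Fintype.card V ≤ p.length) : ∃ x, ∃ _ : Path a x, ∃ _ : Path x b, IsCyclicVertex x := by
  by_contra! hc
  have hnd := p.nodup_vertices_of_forall_not_isCyclicVertex fun x hx hcyc => by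
    obtain ⟨q, r, -⟩ := p.exists_eq_comp_of_mem_vertices hx
    exact hc x q r hcyc
  have := hnd.length_le_card
  rw [vertices_length] at this
  omega

/-- The quiver condition satisfied by one-sided Noetherian path algebras: cyclic vertices have at
most one arrow to a cyclic vertex, and a path between cyclic vertices only meets such vertices. -/
structure HasIsolatedCycles (V : Type v) [Quiver.{e} V] : Prop where
  arrow_unique : ∀ {c d d' : V} (f : c ⟶ d) (g : c ⟶ d'), IsCyclicVertex c → IsCyclicVertex d →
    IsCyclicVertex d' → (⟨d, f⟩ : Σ d, c ⟶ d) = ⟨d', g⟩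
  isCyclicVertex_of_between : ∀ {c x d : V} (_ : Path c x) (_ : Path x d), IsCyclicVertex c →
    IsCyclicVertex d → IsCyclicVertex x

/-- The only arrow leaving a cyclic vertex leads to a cyclic vertex, so everything reachable from a
cyclic vertex is cyclic. -/
theorem HasIsolatedCycles.of_arrows_out
    (h : ∀ {c d d' : V} (f : c ⟶ d) (g : c ⟶ d'), IsCyclicVertex c →
      (⟨d, f⟩ : Σ d, c ⟶ d) = ⟨d', g⟩) : HasIsolatedCycles V where
  arrow_unique f g hc _ _ := h f g hc
  isCyclicVertex_of_between {c x d} p _ hc _ := by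
    induction p with
    | nil => exact hc
    | @cons y z p f ih =>
      have hy := ih (f.toPath.comp ‹_›)
      obtain ⟨z', g, hz'⟩ := hy.exists_succ
      have := congrArg Sigma.fst (h f g hy)
      rw [show z = z' from this]
      exact hz'

/-- Dually, everything leading to a cyclic vertex is cyclic. Uniqueness of outgoing arrows needs
finiteness: the predecessor map on cyclic vertices is surjective, hence injective. -/
theorem HasIsolatedCycles.of_arrows_in [Finite V]
    (h : ∀ {c d d' : V} (f : d ⟶ c) (g : d' ⟶ c), IsCyclicVertex c →
      (⟨d, f⟩ : Σ d, d ⟶ c) = ⟨d', g⟩) : HasIsolatedCycles V where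
  arrow_unique {c d d'} f g hc hd hd' := by
    choose pred arr hpred using fun x : {x : V // IsCyclicVertex x} => x.2.exists_pred
    let π : {x : V // IsCyclicVertex x} → {x : V // IsCyclicVertex x} :=
      fun x => ⟨pred x, hpred x⟩
    have hπ : ∀ (x y : {x : V // IsCyclicVertex x}) (_ : y.1 ⟶ x.1), π x = y := fun x y f =>
      Subtype.ext (congrArg Sigma.fst (h (arr x) f x.2))
    have hsurj : Function.Surjective π := fun y => by
      obtain ⟨z, f, hz⟩ := y.2.exists_succ
      exact ⟨⟨z, hz⟩, hπ ⟨z, hz⟩ y f⟩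
    have hinj := Finite.injective_iff_surjective.2 hsurj
    have hdd : d = d' := congrArg Subtype.val
      (hinj ((hπ ⟨d, hd⟩ ⟨c, hc⟩ f).trans (hπ ⟨d', hd'⟩ ⟨c, hc⟩ g).symm))
    subst hdd
    have := h f g hd
    rw [Sigma.mk.injEq] at this
    rw [eq_of_heq this.2]
  isCyclicVertex_of_between {c x d} _ q _ hd := by
    induction q with
    | nil => exact hd
    | @cons y z q f ih =>
      obtain ⟨y', g, hy'⟩ := hd.exists_pred
      have := congrArg Sigma.fst (h f g hd)
      exact ih (by rw [show y = y' from this]; exact hy')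

end Combinatorics

/-! ### One-sided Noetherian path algebras -/

namespace PathAlgebra

open Quiver (Path)

variable {k : Type u} [Field k] {V : Type v} [Quiver.{e} V]

variable (k) in
/-- The subspace spanned by a set of paths. -/
noncomputable def pathSpan (S : Set (QuiverPath V)) : Submodule k (PathAlgebra k V) :=
  Submodule.span k (ofPath k '' S)

theorem ofPath_mem_pathSpan_iff {S : Set (QuiverPath V)} {p : QuiverPath V} :
    ofPath k p ∈ pathSpan k S ↔ p ∈ S := by
  have h := Finsupp.supported_eq_span_single k S
  change (Finsupp.single p 1 : QuiverPath V →₀ k) ∈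
    Submodule.span k ((fun i => (Finsupp.single i 1 : QuiverPath V →₀ k)) '' S) ↔ p ∈ S
  rw [← h, Finsupp.mem_supported]
  simp

theorem pathSpan_mono {S T : Set (QuiverPath V)} (h : S ⊆ T) : pathSpan k S ≤ pathSpan k T :=
  Submodule.span_mono (Set.image_mono h)

theorem mul_mem_pathSpan_of_left {S : Set (QuiverPath V)}
    (hS : ∀ {a b c : V} (p : Path a b) (q : Path b c), ⟨a, b, p⟩ ∈ S → ⟨a, c, p.comp q⟩ ∈ S)
    {x : PathAlgebra k V} (hx : x ∈ pathSpan k S) (y : PathAlgebra k V) :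
    x * y ∈ pathSpan k S := by
  induction hx using Submodule.span_induction with
  | zero => rw [PathAlgebra.zero_mul']; exact zero_mem _
  | add x x' _ _ h h' => rw [PathAlgebra.add_mul']; exact add_mem h h'
  | smul c x _ h => rw [PathAlgebra.smul_mul']; exact Submodule.smul_mem _ _ h
  | mem x hx =>
    obtain ⟨⟨a, b, p⟩, hp, rfl⟩ := hx
    induction y using induction_on with
    | zero => rw [PathAlgebra.mul_zero']; exact zero_mem _
    | add y y' h h' => rw [PathAlgebra.mul_add']; exact add_mem h h'
    | smul c q =>
      rw [PathAlgebra.mul_smul']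
      refine Submodule.smul_mem _ _ ?_
      obtain ⟨b', d, q⟩ := q
      by_cases h : b = b'
      · subst h
        rw [ofPath_mul_ofPath_of_eq]
        exact ofPath_mem_pathSpan_iff.2 (hS p q hp)
      · rw [ofPath_mul_ofPath_of_ne _ _ h]
        exact zero_mem _

theorem mul_mem_pathSpan_of_right {S : Set (QuiverPath V)}
    (hS : ∀ {a b c : V} (p : Path a b) (q : Path b c), ⟨b, c, q⟩ ∈ S → ⟨a, c, p.comp q⟩ ∈ S)
    (y : PathAlgebra k V) {x : PathAlgebra k V} (hx : x ∈ pathSpan k S) :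
    y * x ∈ pathSpan k S := by
  induction hx using Submodule.span_induction with
  | zero => rw [PathAlgebra.mul_zero']; exact zero_mem _
  | add x x' _ _ h h' => rw [PathAlgebra.mul_add']; exact add_mem h h'
  | smul c x _ h => rw [PathAlgebra.mul_smul']; exact Submodule.smul_mem _ _ h
  | mem x hx =>
    obtain ⟨⟨b, c, q⟩, hq, rfl⟩ := hx
    induction y using induction_on with
    | zero => rw [PathAlgebra.zero_mul']; exact zero_mem _
    | add y y' h h' => rw [PathAlgebra.add_mul']; exact add_mem h h'
    | smul r p =>
      rw [PathAlgebra.smul_mul']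
      refine Submodule.smul_mem _ _ ?_
      obtain ⟨a, b', p⟩ := p
      by_cases h : b' = b
      · subst h
        rw [ofPath_mul_ofPath_of_eq]
        exact ofPath_mem_pathSpan_iff.2 (hS p q hq)
      · rw [ofPath_mul_ofPath_of_ne _ _ h]
        exact zero_mem _

/-- In a right Noetherian path algebra, ascending sequences of sets of paths which are stable
under extension to the right are stationary. -/
theorem exists_stationary_of_isNoetherianRing_op [Fintype V]
    [hN : IsNoetherianRing (PathAlgebra k V)ᵐᵒᵖ] (S : ℕ → Set (QuiverPath V)) (hmono : Monotone S)
    (hS : ∀ n {a b c : V} (p : Path a b) (q : Path b c), ⟨a, b, p⟩ ∈ S n →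
      ⟨a, c, p.comp q⟩ ∈ S n) : ∃ n, ∀ m, n ≤ m → S m ⊆ S n := by
  let I : ℕ →o Ideal (PathAlgebra k V)ᵐᵒᵖ :=
    { toFun n :=
        { carrier := {z | z.unop ∈ pathSpan k (S n)}
          add_mem' := fun h h' => (pathSpan k (S n)).add_mem h h'
          zero_mem' := zero_mem (pathSpan k (S n))
          smul_mem' := fun c _ hz => mul_mem_pathSpan_of_left (hS n) hz c.unop }
      monotone' n m h _ hz := pathSpan_mono (hmono h) hz }
  obtain ⟨n, hn⟩ := monotone_stabilizes_iff_noetherian.2 hN I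
  refine ⟨n, fun m hm p hp => ?_⟩
  have : MulOpposite.op (ofPath k p) ∈ I m := (ofPath_mem_pathSpan_iff (k := k)).2 hp
  rw [← hn m hm] at this
  exact (ofPath_mem_pathSpan_iff (k := k)).1 this

/-- In a left Noetherian path algebra, ascending sequences of sets of paths which are stable
under extension to the left are stationary. -/
theorem exists_stationary_of_isNoetherianRing [Fintype V]
    [hN : IsNoetherianRing (PathAlgebra k V)] (S : ℕ → Set (QuiverPath V)) (hmono : Monotone S)
    (hS : ∀ n {a b c : V} (p : Path a b) (q : Path b c), ⟨b, c, q⟩ ∈ S n →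
      ⟨a, c, p.comp q⟩ ∈ S n) : ∃ n, ∀ m, n ≤ m → S m ⊆ S n := by
  let I : ℕ →o Ideal (PathAlgebra k V) :=
    { toFun n :=
        { carrier := {z | z ∈ pathSpan k (S n)}
          add_mem' := fun h h' => (pathSpan k (S n)).add_mem h h'
          zero_mem' := zero_mem (pathSpan k (S n))
          smul_mem' := fun c _ hz => mul_mem_pathSpan_of_right (hS n) c hz }
      monotone' n m h _ hz := pathSpan_mono (hmono h) hz }
  obtain ⟨n, hn⟩ := monotone_stabilizes_iff_noetherian.2 hN I
  refine ⟨n, fun m hm p hp => ?_⟩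
  have : ofPath k p ∈ I m := (ofPath_mem_pathSpan_iff (k := k)).2 hp
  rw [← hn m hm] at this
  exact (ofPath_mem_pathSpan_iff (k := k)).1 this

/-! ### Chain conditions and the arrows at a cyclic vertex. -/

theorem exists_path_arrows_eq_flatten_replicate {c : V} (p : Path c c) (n : ℕ) :
    ∃ q : Path c c, q.arrows = (List.replicate n p.arrows).flatten := by
  induction n with
  | zero => exact ⟨.nil, by simp⟩
  | succ n ih =>
    obtain ⟨q, hq⟩ := ih
    exact ⟨p.comp q, by rw [Quiver.Path.arrows_comp, hq, List.replicate_succ, List.flatten_cons]⟩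

/-- The paths starting with `pⁱf` for some `i ≤ n` span an ascending chain of right ideals. Since
`p` is fixed and `f` arbitrary, all arrows leaving `c` coincide. -/
theorem head?_arrows_of_isNoetherianRing_op [Fintype V] (hN : IsNoetherianRing (PathAlgebra k V)ᵐᵒᵖ)
    {c d : V} (p : Path c c) (hp : 0 < p.length) (f : c ⟶ d) :
    p.arrows.head? = some ⟨c, d, f⟩ := by
  let L (i : ℕ) := (List.replicate i p.arrows).flatten
  let S (n : ℕ) : Set (QuiverPath V) := {q | ∃ i ≤ n, L i ++ [⟨c, d, f⟩] <+: q.2.2.arrows}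
  obtain ⟨n, hn⟩ := exists_stationary_of_isNoetherianRing_op (k := k) S
    (fun n m h q ⟨i, hi, hq⟩ => ⟨i, hi.trans h, hq⟩)
    (fun n a b c' q r ⟨i, hi, hq⟩ => ⟨i, hi, by
      change _ <+: (q.comp r).arrows
      rw [Quiver.Path.arrows_comp]
      exact hq.trans (List.prefix_append _ _)⟩)
  obtain ⟨q, hq⟩ := exists_path_arrows_eq_flatten_replicate p (n + 1)
  obtain ⟨i, hi, h⟩ := hn (n + 1) n.le_succ
    (show (⟨c, d, q.cons f⟩ : QuiverPath V) ∈ S (n + 1) from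
      ⟨n + 1, le_rfl, by simp only [Quiver.Path.arrows_cons, hq, L]; exact List.prefix_rfl⟩)
  obtain ⟨j, rfl⟩ := Nat.exists_eq_add_of_le hi
  simp only [Quiver.Path.arrows_cons, hq, L] at h
  -- Here `n = i + j`. Cancelling `pⁱ` leaves `f` as a prefix of `p^(j+1) f`, whose first arrow is
  -- that of `p`.
  rw [add_assoc, List.replicate_add, List.flatten_append, List.append_assoc,
    List.prefix_append_right_inj, List.replicate_succ, List.flatten_cons] at h
  have hne : p.arrows ≠ [] := by
    rw [← List.length_pos_iff, Quiver.Path.length_arrows]; exact hp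
  obtain ⟨g, l, hgl⟩ := List.exists_cons_of_ne_nil hne
  rw [hgl] at h ⊢
  simp only [List.cons_append, List.cons_prefix_cons] at h
  rw [h.1, List.head?_cons]

/-- Mirror image of the previous argument, with the left ideals spanned by the paths ending in `f
pⁱ`, `i ≤ n`. -/
theorem getLast?_arrows_of_isNoetherianRing [Fintype V] (hN : IsNoetherianRing (PathAlgebra k V))
    {c d : V} (p : Path c c) (hp : 0 < p.length) (f : d ⟶ c) :
    p.arrows.getLast? = some ⟨d, c, f⟩ := by
  let L (i : ℕ) := (List.replicate i p.arrows).flatten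
  let S (n : ℕ) : Set (QuiverPath V) := {q | ∃ i ≤ n, ⟨d, c, f⟩ :: L i <:+ q.2.2.arrows}
  obtain ⟨n, hn⟩ := exists_stationary_of_isNoetherianRing (k := k) S
    (fun n m h q ⟨i, hi, hq⟩ => ⟨i, hi.trans h, hq⟩)
    (fun n a b c' q r ⟨i, hi, hq⟩ => ⟨i, hi, by
      change _ <:+ (q.comp r).arrows
      rw [Quiver.Path.arrows_comp]
      exact hq.trans (List.suffix_append _ _)⟩)
  obtain ⟨q, hq⟩ := exists_path_arrows_eq_flatten_replicate p (n + 1)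
  have harr : (f.toPath.comp q).arrows = ⟨d, c, f⟩ :: L (n + 1) := by
    rw [Quiver.Path.arrows_comp, hq]; rfl
  obtain ⟨i, hi, h⟩ := hn (n + 1) n.le_succ
    (show (⟨d, c, f.toPath.comp q⟩ : QuiverPath V) ∈ S (n + 1) from
      ⟨n + 1, le_rfl, by rw [harr]⟩)
  obtain ⟨j, rfl⟩ := Nat.exists_eq_add_of_le hi
  have hsplit : L (i + j + 1) = L (j + 1) ++ L i := by
    simp only [L]
    rw [show i + j + 1 = (j + 1) + i by omega, List.replicate_add, List.flatten_append]
  rw [harr, hsplit, ← List.singleton_append, ← List.cons_append,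
    List.suffix_append_self_iff] at h
  have hne : p.arrows ≠ [] := by
    rw [← List.length_pos_iff, Quiver.Path.length_arrows]; exact hp
  have hlast := List.singleton_suffix_iff_getLast?_eq_some.1 h
  rw [← hlast]
  have hL : L (j + 1) = L j ++ p.arrows := by
    simp only [L]
    rw [List.replicate_add, List.flatten_append]; simp
  rw [hL, ← List.cons_append, List.getLast?_append_of_ne_nil _ hne]

theorem hasIsolatedCycles_of_isNoetherianRing [Fintype V]
    (hN : IsNoetherianRing (PathAlgebra k V) ∨ IsNoetherianRing (PathAlgebra k V)ᵐᵒᵖ) :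
    HasIsolatedCycles V := by
  rcases hN with hN | hN
  · refine .of_arrows_in fun {c d d'} f g hc => ?_
    obtain ⟨p, hp⟩ := isCyclicVertex_iff.1 hc
    have := (getLast?_arrows_of_isNoetherianRing hN p hp f).symm.trans
      (getLast?_arrows_of_isNoetherianRing hN p hp g)
    cases this
    rfl
  · refine .of_arrows_out fun {c d d'} f g hc => ?_
    obtain ⟨p, hp⟩ := isCyclicVertex_iff.1 hc
    have := (head?_arrows_of_isNoetherianRing_op hN p hp f).symm.trans
      (head?_arrows_of_isNoetherianRing_op hN p hp g)
    cases this
    rfl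

end PathAlgebra

/-! ### The successor permutation of the cyclic vertices -/

section Successor

variable {V : Type v} [Quiver.{e} V]

variable (V) in
/-- The type of cyclic vertices. -/
abbrev CyclicVertex : Type v := {x : V // IsCyclicVertex x}

noncomputable instance [Finite V] : Fintype (CyclicVertex V) := Fintype.ofFinite _

namespace CyclicVertex

/-- A cyclic vertex following a given one. -/
noncomputable def next (c : CyclicVertex V) : CyclicVertex V :=
  ⟨c.2.exists_succ.choose, c.2.exists_succ.choose_spec.choose_spec⟩

/-- An arrow from a cyclic vertex to a following one. -/
noncomputable def nextArrow (c : CyclicVertex V) : c.1 ⟶ c.next.1 :=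
  c.2.exists_succ.choose_spec.choose

end CyclicVertex

namespace HasIsolatedCycles

variable (h : HasIsolatedCycles V)

include h

theorem arrow_eq_nextArrow (c d : CyclicVertex V) (f : c.1 ⟶ d.1) :
    (⟨d.1, f⟩ : Σ y, c.1 ⟶ y) = ⟨c.next.1, c.nextArrow⟩ :=
  h.arrow_unique f c.nextArrow c.2 d.2 c.next.2

theorem next_surjective : Function.Surjective (CyclicVertex.next (V := V)) := fun d => by
  obtain ⟨c, f, hc⟩ := d.2.exists_pred
  exact ⟨⟨c, hc⟩, Subtype.ext (congrArg Sigma.fst (h.arrow_eq_nextArrow ⟨c, hc⟩ d f)).symm⟩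

/-- The successor permutation of the cyclic vertices. -/
noncomputable def perm [Finite V] : Equiv.Perm (CyclicVertex V) :=
  Equiv.ofBijective _ ⟨Finite.injective_iff_surjective.2 h.next_surjective, h.next_surjective⟩

theorem perm_apply [Finite V] (c : CyclicVertex V) : h.perm c = c.next := rfl

end HasIsolatedCycles

end Successor

namespace PathAlgebra

open Quiver (Path)

variable (k : Type u) [Field k] {V : Type v} [Quiver.{e} V]

/-- The idempotent given by the trivial path at a vertex. -/
noncomputable def idem (a : V) : PathAlgebra k V := ofPath k ⟨a, a, Path.nil⟩

variable (V) in
/-- The sum of the arrows between successive cyclic vertices. -/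
noncomputable def cycleElt [Finite V] : PathAlgebra k V :=
  ∑ c : CyclicVertex V, ofPath k ⟨c.1, c.next.1, c.nextArrow.toPath⟩

variable {k}

theorem idem_mul_ofPath {a b : V} (p : Path a b) :
    idem k a * ofPath k ⟨a, b, p⟩ = ofPath k ⟨a, b, p⟩ := by
  rw [idem, ofPath_mul_ofPath_of_eq, Path.nil_comp]

theorem ofPath_mul_idem {a b : V} (p : Path a b) :
    ofPath k ⟨a, b, p⟩ * idem k b = ofPath k ⟨a, b, p⟩ := by
  rw [idem, ofPath_mul_ofPath_of_eq, Path.comp_nil]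

theorem idem_mul_ofPath_of_ne {a b c : V} (p : Path a b) (h : c ≠ a) :
    idem k c * ofPath k ⟨a, b, p⟩ = 0 :=
  ofPath_mul_ofPath_of_ne _ _ h

theorem ofPath_mul_idem_of_ne {a b c : V} (p : Path a b) (h : b ≠ c) :
    ofPath k ⟨a, b, p⟩ * idem k c = 0 :=
  ofPath_mul_ofPath_of_ne _ _ h

theorem idem_mem_grading (a : V) : idem k a ∈ grading k V 0 := ofPath_mem_grading ⟨a, a, Path.nil⟩

theorem idem_mul_idem (a : V) : idem k a * idem k a = idem k a := idem_mul_ofPath _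

theorem idem_mul_idem_of_ne {a b : V} (h : a ≠ b) : idem k a * idem k b = 0 :=
  idem_mul_ofPath_of_ne _ h

variable [Fintype V]

theorem idem_mul_cycleElt (c : CyclicVertex V) :
    idem k c.1 * cycleElt k V = ofPath k ⟨c.1, c.next.1, c.nextArrow.toPath⟩ := by
  rw [cycleElt, Finset.mul_sum, Finset.sum_eq_single c, idem_mul_ofPath]
  · exact fun d _ hd => idem_mul_ofPath_of_ne _ fun h => hd (Subtype.ext h.symm)
  · simp

theorem idem_mul_cycleElt_of_not {a : V} (ha : ¬ IsCyclicVertex a) :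
    idem k a * cycleElt k V = 0 := by
  rw [cycleElt, Finset.mul_sum]
  exact Finset.sum_eq_zero fun d _ => idem_mul_ofPath_of_ne _ fun h => ha (h ▸ d.2)

theorem cycleElt_mem_grading : cycleElt k V ∈ grading k V 1 :=
  Submodule.sum_mem _ fun c _ => ofPath_mem_grading ⟨c.1, c.next.1, c.nextArrow.toPath⟩

theorem cycleElt_pow_mem_grading (n : ℕ) : cycleElt k V ^ n ∈ grading k V n := by
  simpa using SetLike.pow_mem_graded n (cycleElt_mem_grading (k := k) (V := V))

variable (h : HasIsolatedCycles V)

include h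

/-- Injectivity of the permutation makes the arrow from `c` the only summand ending at its
successor. -/
theorem cycleElt_mul_idem_next (c : CyclicVertex V) :
    cycleElt k V * idem k c.next.1 = idem k c.1 * cycleElt k V := by
  rw [idem_mul_cycleElt, cycleElt, Finset.sum_mul, Finset.sum_eq_single c, ofPath_mul_idem]
  · exact fun d _ hd => ofPath_mul_idem_of_ne _ fun h' =>
      hd (h.perm.injective (Subtype.ext h'))
  · simp

theorem idem_mul_cycleElt_pow (c : CyclicVertex V) (n : ℕ) :
    idem k c.1 * cycleElt k V ^ n = cycleElt k V ^ n * idem k ((h.perm ^ n) c).1 := by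
  induction n with
  | zero => simp
  | succ n ih =>
    rw [pow_succ, ← mul_assoc, ih, mul_assoc, ← cycleElt_mul_idem_next h, ← mul_assoc,
      pow_succ' h.perm]
    rfl

/-- A path between cyclic vertices is determined by its source and its length. -/
theorem ofPath_eq_idem_mul_cycleElt_pow {a b : V} (p : Path a b) (ha : IsCyclicVertex a)
    (hb : IsCyclicVertex b) : ofPath k ⟨a, b, p⟩ = idem k a * cycleElt k V ^ p.length := by
  induction p with
  | nil => rw [Path.length_nil, pow_zero, mul_one]; rfl
  | @cons y z p f ih =>
    have hy : IsCyclicVertex y := h.isCyclicVertex_of_between p f.toPath ha hb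
    have hf : ofPath k ⟨y, z, f.toPath⟩ = idem k y * cycleElt k V := by
      rw [idem_mul_cycleElt ⟨y, hy⟩]
      have := h.arrow_eq_nextArrow ⟨y, hy⟩ ⟨z, hb⟩ f
      exact congrArg (fun s : Σ z, y ⟶ z => ofPath k ⟨y, s.1, s.2.toPath⟩) this
    rw [← Path.comp_toPath_eq_cons, ← ofPath_mul_ofPath_of_eq, hf, ← mul_assoc, ofPath_mul_idem,
      ih hy, mul_assoc, ← pow_succ, Path.length_comp, Path.length_toPath]

/-! ### The twisted action of functions on the cyclic vertices -/

/-- The element of degree zero by which a function on the cyclic vertices acts in degree `j`. -/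
noncomputable def rotate (j : ℤ) (r : CyclicVertex V → k) : PathAlgebra k V :=
  ∑ c : CyclicVertex V, r ((h.perm ^ (-j)) c) • idem k c.1

theorem rotate_mem_grading (j : ℤ) (r : CyclicVertex V → k) :
    rotate h j r ∈ grading k V 0 :=
  Submodule.sum_mem _ fun c _ => Submodule.smul_mem _ _ (idem_mem_grading c.1)

theorem rotate_add (j : ℤ) (r s : CyclicVertex V → k) :
    rotate h j (r + s) = rotate h j r + rotate h j s := by
  simp only [rotate, Pi.add_apply, add_smul, Finset.sum_add_distrib]

theorem rotate_zero (j : ℤ) : rotate h j (0 : CyclicVertex V → k) = 0 := by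
  simp [rotate]

theorem idem_mul_rotate (j : ℤ) (r : CyclicVertex V → k) (c : CyclicVertex V) :
    idem k c.1 * rotate h j r = r ((h.perm ^ (-j)) c) • idem k c.1 := by
  rw [rotate, Finset.mul_sum, Finset.sum_eq_single c]
  · rw [mul_smul_comm, idem_mul_idem]
  · intro d _ hd
    rw [mul_smul_comm, idem_mul_idem_of_ne fun h' => hd (Subtype.ext h'.symm), smul_zero]
  · simp

theorem rotate_mul (j : ℤ) (r s : CyclicVertex V → k) :
    rotate h j (r * s) = rotate h j r * rotate h j s := by
  conv_rhs => rw [rotate, Finset.sum_mul]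
  rw [rotate]
  refine Finset.sum_congr rfl fun c _ => ?_
  rw [smul_mul_assoc, idem_mul_rotate, smul_smul, Pi.mul_apply]

theorem rotate_one_mul_cycleElt (j : ℤ) :
    rotate h j (1 : CyclicVertex V → k) * cycleElt k V = cycleElt k V := by
  conv_rhs => rw [cycleElt]
  rw [rotate, Finset.sum_mul]
  refine Finset.sum_congr rfl fun c _ => ?_
  rw [Pi.one_apply, one_smul, idem_mul_cycleElt]

/-- The twist by `σ^(-j)` exists for this identity: moving `e_c` past the sum of arrows turns it
into `e_(σ c)`, which the change of degree compensates. It lets the action descend to the stable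
fibre. -/
theorem rotate_mul_cycleElt (j : ℤ) (r : CyclicVertex V → k) :
    rotate h j r * cycleElt k V = cycleElt k V * rotate h (j + 1) r := by
  rw [rotate, rotate, Finset.sum_mul, Finset.mul_sum]
  refine Fintype.sum_equiv h.perm _ _ fun c => ?_
  rw [smul_mul_assoc, mul_smul_comm, h.perm_apply, cycleElt_mul_idem_next h, ← h.perm_apply,
    ← Equiv.Perm.mul_apply, ← zpow_add_one, neg_add, neg_add_cancel_right]

end PathAlgebra

/-! ### Gelfand-Kirillov dimension -/

namespace PathAlgebra

open Quiver (Path)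

variable {k : Type u} [Field k] {V : Type v} [Quiver.{e} V]

variable (k V) in
/-- The subspace spanned by the paths of length at most `n`. -/
noncomputable def filtration (n : ℕ) : Submodule k (PathAlgebra k V) :=
  pathSpan k {p | p.2.2.length ≤ n}

theorem filtration_mono : Monotone (filtration k V) := fun _ _ h =>
  pathSpan_mono fun _ hp => le_trans hp h

theorem exists_mem_filtration (x : PathAlgebra k V) : ∃ n, x ∈ filtration k V n := by
  induction x using induction_on with
  | zero => exact ⟨0, zero_mem _⟩
  | add x y hx hy =>
    obtain ⟨n, hn⟩ := hx
    obtain ⟨m, hm⟩ := hy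
    exact ⟨max n m, add_mem (filtration_mono (le_max_left _ _) hn)
      (filtration_mono (le_max_right _ _) hm)⟩
  | smul c p => exact ⟨_, Submodule.smul_mem _ _ (ofPath_mem_pathSpan_iff.2 (le_refl p.2.2.length))⟩

theorem exists_le_filtration {W : Submodule k (PathAlgebra k V)} (hW : W.FG) :
    ∃ n, W ≤ filtration k V n := by
  obtain ⟨s, rfl⟩ := hW
  choose d hd using exists_mem_filtration (k := k) (V := V)
  exact ⟨s.sup d, Submodule.span_le.2 fun x hx => filtration_mono (Finset.le_sup hx) (hd x)⟩

theorem filtration_zero_le : filtration k V 0 ≤ grading k V 0 :=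
  Submodule.span_le.2 (by
    rintro _ ⟨p, hp, rfl⟩
    exact Submodule.subset_span ⟨p, Nat.le_zero.1 hp, rfl⟩)

theorem filtration_succ_le (n : ℕ) :
    filtration k V (n + 1) ≤ filtration k V n ⊔ grading k V (n + 1) :=
  Submodule.span_le.2 (by
    rintro _ ⟨p, hp, rfl⟩
    rcases Nat.le_succ_iff.1 hp with hp | hp
    · exact Submodule.mem_sup_left (ofPath_mem_pathSpan_iff.2 hp)
    · exact Submodule.mem_sup_right (Submodule.subset_span ⟨p, hp, rfl⟩))

/-- A longer path has an initial segment of length `n`; if there were none, all paths would be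
shorter than `n`. -/
theorem exists_path_length_eq (hfin : ¬ ∃ n, filtration k V n = ⊤) (n : ℕ) :
    ∃ p : QuiverPath V, p.2.2.length = n := by
  by_contra! hn
  refine hfin ⟨n, eq_top_iff.2 fun x _ => ?_⟩
  induction x using induction_on with
  | zero => exact zero_mem _
  | add x y hx hy => exact add_mem (hx trivial) (hy trivial)
  | smul c p =>
    refine Submodule.smul_mem _ _ (ofPath_mem_pathSpan_iff.2 ?_)
    by_contra hlt
    obtain ⟨a, b, p⟩ := p
    obtain ⟨c, q, r, -, hq⟩ := p.exists_eq_comp_of_le_length (not_le.1 hlt).le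
    exact hn ⟨a, c, q⟩ hq

variable [Fintype V]

theorem one_mem_filtration : (1 : PathAlgebra k V) ∈ filtration k V 0 :=
  Submodule.sum_mem _ fun _ _ => ofPath_mem_pathSpan_iff.2 (Nat.le_refl 0)

theorem filtration_mul_le (m n : ℕ) :
    filtration k V m * filtration k V n ≤ filtration k V (m + n) := by
  rw [filtration, filtration, pathSpan, pathSpan, Submodule.span_mul_span, Submodule.span_le]
  rintro _ ⟨_, ⟨⟨a, b, p⟩, hp, rfl⟩, _, ⟨⟨b', c, q⟩, hq, rfl⟩, rfl⟩
  by_cases hb : b = b'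
  · subst hb
    simp only [ofPath_mul_ofPath_of_eq]
    refine ofPath_mem_pathSpan_iff.2 ?_
    simp only [Set.mem_ofPred_eq, Path.length_comp] at hp hq ⊢
    omega
  · simp only [ofPath_mul_ofPath_of_ne _ _ hb]
    exact zero_mem _

theorem pow_le_filtration {W : Submodule k (PathAlgebra k V)} {d : ℕ}
    (hW : W ≤ filtration k V d) (n : ℕ) : W ^ n ≤ filtration k V (d * n) := by
  induction n with
  | zero => rw [pow_zero, Submodule.one_le, mul_zero]; exact one_mem_filtration
  | succ n ih =>
    rw [pow_succ, mul_add, mul_one]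
    exact (mul_le_mul' ih hW).trans (filtration_mul_le _ _)

theorem iSup_pow_le_filtration {W : Submodule k (PathAlgebra k V)} {d : ℕ}
    (hW : W ≤ filtration k V d) (n : ℕ) :
    (⨆ i : Fin (n + 1), W ^ (i : ℕ)) ≤ filtration k V (d * n) :=
  iSup_le fun i => (pow_le_filtration hW i).trans
    (filtration_mono (Nat.mul_le_mul_left _ (Nat.lt_succ_iff.1 i.2)))

theorem grading_succ_le (n : ℕ) : grading k V (n + 1) ≤ grading k V n * grading k V 1 :=
  Submodule.span_le.2 (by
    rintro _ ⟨⟨a, b, p⟩, hp, rfl⟩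
    cases p with
    | nil => simp at hp
    | @cons c _ p f =>
      rw [← Path.comp_toPath_eq_cons, ← ofPath_mul_ofPath_of_eq]
      exact Submodule.mul_mem_mul (Submodule.subset_span ⟨⟨a, c, p⟩, Nat.succ_injective hp, rfl⟩)
        (ofPath_mem_grading ⟨c, b, f.toPath⟩))

theorem grading_succ_le_pow (n : ℕ) : grading k V (n + 1) ≤ grading k V 1 ^ (n + 1) := by
  induction n with
  | zero => rw [zero_add, pow_one]
  | succ n ih =>
    rw [pow_succ]
    exact (grading_succ_le _).trans (mul_le_mul' ih le_rfl)

theorem grading_zero_fg : (grading k V 0).FG := by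
  refine Submodule.fg_span ((Set.finite_range (idem k (V := V))).subset ?_)
  rintro _ ⟨⟨a, b, p⟩, hp, rfl⟩
  cases p with
  | nil => exact ⟨a, rfl⟩
  | cons p f => simp at hp

variable [∀ a b : V, Finite (a ⟶ b)]

theorem grading_one_fg : (grading k V 1).FG := by
  refine Submodule.fg_span ((Set.finite_range fun f : Σ x y : V, x ⟶ y =>
    ofPath k ⟨f.1, f.2.1, f.2.2.toPath⟩).subset ?_)
  rintro _ ⟨⟨a, b, p⟩, hp, rfl⟩
  cases p with
  | nil => simp at hp
  | @cons c _ p f =>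
    cases p with
    | nil => exact ⟨⟨a, b, f⟩, rfl⟩
    | cons p g => simp at hp

theorem grading_fg (n : ℕ) : (grading k V n).FG := by
  induction n with
  | zero => exact grading_zero_fg
  | succ n ih =>
    have := Module.Finite.iff_fg.2 (ih.mul (grading_one_fg (k := k) (V := V)))
    exact Module.Finite.iff_fg.1 (Submodule.finiteDimensional_of_le (grading_succ_le n))

instance (n : ℕ) : Module.Finite k (grading k V n) := Module.Finite.iff_fg.2 (grading_fg n)

instance (n : ℕ) : Module.Finite k (filtration k V n) := by
  induction n with
  | zero => exact Submodule.finiteDimensional_of_le filtration_zero_le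
  | succ n ih => exact Submodule.finiteDimensional_of_le (filtration_succ_le n)

theorem exists_path_length_eq_of_not_finite (hfin : ¬ Module.Finite k (PathAlgebra k V)) (n : ℕ) :
    ∃ p : QuiverPath V, p.2.2.length = n :=
  exists_path_length_eq (k := k) (fun ⟨_, hn⟩ => hfin (Module.finite_def.2
    (hn ▸ Module.Finite.iff_fg.1 inferInstance))) n

-- For large `n`, `A_n` lies in `A_N x^(n-2N) A_N` with `N = |V|`, which is spanned by `|s|²`
-- products where `s` is a finite spanning set of `A_N`. The finitely many smaller degrees are
-- absorbed by a maximum.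
open scoped Pointwise in
theorem exists_finrank_grading_le (h : HasIsolatedCycles V) :
    ∃ C : ℕ, ∀ n, Module.finrank k (grading k V n) ≤ C := by
  classical
  set N := Fintype.card V
  obtain ⟨s, hs⟩ := grading_fg (k := k) (V := V) N
  refine ⟨max (s.card * s.card)
    ((Finset.range (2 * N)).sup fun n => Module.finrank k (grading k V n)), fun n => ?_⟩
  rcases lt_or_ge n (2 * N) with hn | hn
  · exact le_max_of_le_right (Finset.le_sup (f := fun n => Module.finrank k (grading k V n))
      (Finset.mem_range.2 hn))
  refine le_max_of_le_left ?_
  have key : grading k V n ≤ Submodule.span k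
      ((s * {cycleElt k V ^ (n - 2 * N)} * s : Finset (PathAlgebra k V)) : Set _) := by
    rw [Finset.coe_mul, Finset.coe_mul, ← Submodule.span_mul_span, ← Submodule.span_mul_span, hs,
      Finset.coe_singleton]
    refine Submodule.span_le.2 ?_
    rintro _ ⟨⟨a, d, p⟩, hp, rfl⟩
    simp only at hp
    obtain ⟨b, p₁, q, rfl, hp₁⟩ := p.exists_eq_comp_of_le_length (n := N) (by omega)
    rw [Path.length_comp] at hp
    obtain ⟨c, p₂, p₃, rfl, hp₂⟩ := q.exists_eq_comp_of_le_length (n := n - 2 * N) (by omega)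
    rw [Path.length_comp] at hp
    -- Both outer pieces meet cyclic vertices, so the ends `b` and `c` of the middle piece lie
    -- between cyclic vertices.
    obtain ⟨x, _, r₁, hx⟩ := p₁.exists_isCyclicVertex hp₁.ge
    obtain ⟨y, r₂, _, hy⟩ := p₃.exists_isCyclicVertex (show N ≤ _ by omega)
    have hb : IsCyclicVertex b := h.isCyclicVertex_of_between r₁ (p₂.comp r₂) hx hy
    have hc : IsCyclicVertex c := h.isCyclicVertex_of_between (r₁.comp p₂) r₂ hx hy
    rw [← ofPath_mul_ofPath_of_eq, ← ofPath_mul_ofPath_of_eq,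
      ofPath_eq_idem_mul_cycleElt_pow h p₂ hb hc, ← mul_assoc, ← mul_assoc, ofPath_mul_idem, hp₂]
    exact Submodule.mul_mem_mul (Submodule.mul_mem_mul
      (Submodule.subset_span ⟨⟨a, b, p₁⟩, hp₁, rfl⟩) (Submodule.mem_span_singleton_self _))
      (Submodule.subset_span ⟨⟨c, d, p₃⟩, show p₃.length = N by omega, rfl⟩)
  refine (Submodule.finrank_mono key).trans ((finrank_span_finset_le_card _).trans ?_)
  refine Finset.card_mul_le.trans ?_
  refine Nat.mul_le_mul_right _ (Finset.card_mul_le.trans ?_)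
  rw [Finset.card_singleton, mul_one]

theorem exists_finrank_filtration_le (h : HasIsolatedCycles V) :
    ∃ C : ℕ, ∀ n, Module.finrank k (filtration k V n) ≤ C * (n + 1) := by
  obtain ⟨C, hC⟩ := exists_finrank_grading_le (k := k) h
  refine ⟨C, fun n => ?_⟩
  induction n with
  | zero => simpa using (Submodule.finrank_mono filtration_zero_le).trans (hC 0)
  | succ n ih =>
    refine (Submodule.finrank_mono (filtration_succ_le n)).trans
      ((Submodule.finrank_add_le_finrank_add_finrank _ _).trans ?_)
    rw [mul_add_one C (n + 1)]
    exact add_le_add ih (hC _)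

theorem le_finrank_iSup_pow_grading_one (hfin : ¬ Module.Finite k (PathAlgebra k V)) (n : ℕ) :
    n ≤ Module.finrank k (⨆ i : Fin (n + 1), grading k V 1 ^ (i : ℕ) :
      Submodule k (PathAlgebra k V)) := by
  choose p hp using exists_path_length_eq_of_not_finite hfin
  obtain ⟨d, hd⟩ := exists_le_filtration (grading_one_fg (k := k) (V := V))
  -- One path of each length from `1` to `n`. Length `0` is left out: the zeroth power of a subspace
  -- contains only the multiples of `1`, not every trivial path.
  have hli : LinearIndependent k fun i : Fin n => ofPath k (p (i + 1)) := by
    have := (Finsupp.basisSingleOne (R := k) (ι := QuiverPath V)).linearIndependent.comp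
      (fun i : Fin n => p (i + 1)) fun i j hij => by
        have := congrArg (fun q : QuiverPath V => q.2.2.length) hij
        simp only [hp] at this
        exact Fin.ext (Nat.succ_injective this)
    rw [Finsupp.coe_basisSingleOne] at this
    exact this
  have hle : Submodule.span k (Set.range fun i : Fin n => ofPath k (p (i + 1))) ≤
      ⨆ i : Fin (n + 1), grading k V 1 ^ (i : ℕ) := by
    rw [Submodule.span_le]
    rintro _ ⟨i, rfl⟩
    refine Submodule.mem_iSup_of_mem i.succ (grading_succ_le_pow i ?_)
    exact Submodule.subset_span ⟨_, hp _, rfl⟩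
  -- Monotonicity of `Module.finrank` needs this, as its value on an infinite-dimensional space is
  -- `0`.
  have : Module.Finite k (⨆ i : Fin (n + 1), grading k V 1 ^ (i : ℕ) :
      Submodule k (PathAlgebra k V)) :=
    Submodule.finiteDimensional_of_le (iSup_pow_le_filtration hd n)
  have := Submodule.finrank_mono hle
  rwa [finrank_span_eq_card hli, Fintype.card_fin] at this

end PathAlgebra

/-! ### From linear growth to Gelfand-Kirillov dimension one. -/

theorem tendsto_log_const_mul_div_log {K : ℝ} (hK : 0 < K) :
    Filter.Tendsto (fun n : ℕ => Real.log (K * n) / Real.log n) Filter.atTop (nhds 1) := by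
  have hlog : Filter.Tendsto (fun n : ℕ => Real.log n) Filter.atTop Filter.atTop :=
    Real.tendsto_log_atTop.comp tendsto_natCast_atTop_atTop
  have h0 := (hlog.const_div_atTop (Real.log K)).add_const 1
  rw [zero_add] at h0
  refine h0.congr' ?_
  filter_upwards [Filter.eventually_ge_atTop (2 : ℕ)] with n hn
  have hn' : (1 : ℝ) < n := by exact_mod_cast hn
  have := Real.log_pos hn'
  rw [Real.log_mul hK.ne' (by positivity), add_div, div_self this.ne']

namespace PathAlgebra

variable {k : Type u} [Field k] {V : Type v} [Quiver.{e} V] [Fintype V]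
  [∀ a b : V, Finite (a ⟶ b)]

theorem gkDim_le_one (h : HasIsolatedCycles V) : gkDim k (PathAlgebra k V) ≤ 1 := by
  refine iSup_le fun ⟨W, hW⟩ => ?_
  obtain ⟨d, hd⟩ := exists_le_filtration hW
  obtain ⟨C, hC⟩ := exists_finrank_filtration_le (k := k) h
  -- The dimension is at most `C (d n + 1)`, hence at most `(C + 1)(d + 1) n` for `n ≥ 1`; the added
  -- ones keep the constant positive.
  have hK : (0 : ℝ) < (C + 1) * (d + 1) := by positivity
  have hlim := (continuous_coe_real_ereal.tendsto _).comp (tendsto_log_const_mul_div_log hK)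
  rw [← EReal.coe_one, ← hlim.limsup_eq]
  refine Filter.limsup_le_limsup ?_
  filter_upwards [Filter.eventually_ge_atTop (2 : ℕ)] with n hn
  have hn' : (1 : ℝ) < n := by exact_mod_cast hn
  rw [Function.comp_apply, EReal.coe_le_coe_iff]
  refine div_le_div_of_nonneg_right ?_ (Real.log_pos hn').le
  have hb : Module.finrank k (⨆ i : Fin (n + 1), W ^ (i : ℕ) : Submodule k (PathAlgebra k V)) ≤
      (C + 1) * (d + 1) * n :=
    (Submodule.finrank_mono (iSup_pow_le_filtration hd n)).trans ((hC _).trans (by nlinarith))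
  have hb' : (Module.finrank k (⨆ i : Fin (n + 1), W ^ (i : ℕ) :
      Submodule k (PathAlgebra k V)) : ℝ) ≤ (C + 1) * (d + 1) * n := by exact_mod_cast hb
  rcases Nat.eq_zero_or_pos (Module.finrank k (⨆ i : Fin (n + 1), W ^ (i : ℕ) :
      Submodule k (PathAlgebra k V))) with h0 | h0
  -- The dimension can vanish when the algebra is the zero ring; then `Real.log 0 = 0`.
  · rw [h0, Nat.cast_zero, Real.log_zero]
    refine Real.log_nonneg ?_
    have : 1 ≤ (C + 1) * (d + 1) * n := Nat.one_le_iff_ne_zero.2 (by positivity)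
    exact_mod_cast this
  · exact Real.log_le_log (by exact_mod_cast h0) hb'

theorem one_le_gkDim (hfin : ¬ Module.Finite k (PathAlgebra k V)) :
    1 ≤ gkDim k (PathAlgebra k V) := by
  refine le_iSup_of_le ⟨grading k V 1, grading_one_fg⟩ ?_
  rw [← Filter.limsup_const (f := (Filter.atTop : Filter ℕ)) (1 : EReal)]
  refine Filter.limsup_le_limsup ?_
  filter_upwards [Filter.eventually_ge_atTop (2 : ℕ)] with n hn
  have hn' : (1 : ℝ) < n := by exact_mod_cast hn
  rw [← EReal.coe_one, EReal.coe_le_coe_iff, one_le_div (Real.log_pos hn')]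
  exact Real.log_le_log (by linarith)
    (Nat.cast_le.2 (le_finrank_iSup_pow_grading_one hfin n))

end PathAlgebra

/-! ### A criterion for a localization to be equivalent to a given category -/

section Localization

open Localization

/-- If `F` inverts `W` and has a right quasi-inverse `G` such that every object `X` is connected
to `G (F X)` by a natural zigzag in `W`, then `F` induces an equivalence from the localization. -/
theorem CategoryTheory.MorphismProperty.nonempty_localization_equivalence {C D : Type*}
    [Category* C] [Category* D]
    (W : MorphismProperty C) (F : C ⥤ D) (G : D ⥤ C) (E : C ⥤ C) (hF : W.IsInvertedBy F)
    (ε : G ⋙ F ≅ 𝟭 D) (α : E ⟶ 𝟭 C) (β : E ⟶ F ⋙ G) (hα : ∀ X, W (α.app X))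
    (hβ : ∀ X, W (β.app X)) : Nonempty (W.Localization ≌ D) := by
  have hα' : IsIso (Functor.whiskerRight α W.Q) := by
    have : ∀ X, IsIso ((Functor.whiskerRight α W.Q).app X) := fun X =>
      Localization.inverts W.Q W _ (hα X)
    exact NatIso.isIso_of_isIso_app _
  have hβ' : IsIso (Functor.whiskerRight β W.Q) := by
    have : ∀ X, IsIso ((Functor.whiskerRight β W.Q).app X) := fun X =>
      Localization.inverts W.Q W _ (hβ X)
    exact NatIso.isIso_of_isIso_app _
  let L : W.Localization ⥤ D := Localization.lift F hF W.Q
  -- The localization functor inverts both legs of the zigzag, so it becomes an isomorphism that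
  -- descends to the unit of the equivalence.
  let e : W.Q ≅ F ⋙ G ⋙ W.Q :=
    (Functor.leftUnitor _).symm ≪≫ (asIso (Functor.whiskerRight α W.Q)).symm ≪≫
      asIso (Functor.whiskerRight β W.Q)
  let η : 𝟭 W.Localization ≅ L ⋙ (G ⋙ W.Q) :=
    Localization.liftNatIso W.Q W W.Q (F ⋙ G ⋙ W.Q) _ _ e
  let ε' : (G ⋙ W.Q) ⋙ L ≅ 𝟭 D :=
    Functor.associator _ _ _ ≪≫ Functor.isoWhiskerLeft G (Localization.fac F hF W.Q) ≪≫ ε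
  exact ⟨CategoryTheory.Equivalence.mk L (G ⋙ W.Q) η ε'⟩

end Localization

/-! ### Homogeneous components -/

/-- The maps `π j` read off the components of a sum, which gives independence. -/
theorem DirectSum.isInternal_of_projections {M : Type*} [AddCommGroup M] (deg : ℤ → AddSubgroup M)
    (π : ℤ → M →+ M) (hself : ∀ j, ∀ m ∈ deg j, π j m = m)
    (hne : ∀ i j, i ≠ j → ∀ m ∈ deg i, π j m = 0)
    (hsum : ∀ m, ∃ (s : Finset ℤ) (f : ℤ → M), (∀ j, f j ∈ deg j) ∧ m = ∑ j ∈ s, f j) :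
    DirectSum.IsInternal deg := by
  constructor
  · rw [injective_iff_map_eq_zero]
    intro x hx
    have key : ∀ j (y : DirectSum ℤ fun i => deg i),
        π j (DirectSum.coeAddMonoidHom deg y) = (y j : M) := by
      intro j y
      induction y using DirectSum.induction_on with
      | zero => simp
      | of i y =>
        rw [DirectSum.coeAddMonoidHom_of]
        by_cases h : i = j
        · subst h
          rw [hself _ _ y.2, DirectSum.of_eq_same]
        · rw [hne i j h _ y.2, DirectSum.of_eq_of_ne _ _ _ (Ne.symm h)]
          rfl
      | add y z hy hz => rw [map_add, map_add, hy, hz]; rfl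
    refine DFinsupp.ext fun j => Subtype.ext ?_
    rw [← key j x, hx, map_zero]
    rfl
  · intro m
    obtain ⟨s, f, hf, rfl⟩ := hsum m
    refine ⟨∑ j ∈ s, DirectSum.of (fun i => deg i) j ⟨f j, hf j⟩, ?_⟩
    rw [map_sum]
    exact Finset.sum_congr rfl fun j _ => DirectSum.coeAddMonoidHom_of _ _ _

namespace GrModule

variable {k : Type u} [Field k] {A : Type v} [Ring A] [Algebra k A] {𝒜 : ℕ → Submodule k A}
  [GradedAlgebra 𝒜] (M : GrModule.{u, v, w} 𝒜)

theorem induction_on {P : M.carrier → Prop} (m : M.carrier) (zero : P 0)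
    (homogeneous : ∀ j, ∀ m ∈ M.deg j, P m) (add : ∀ m n, P m → P n → P (m + n)) : P m := by
  obtain ⟨x, rfl⟩ := M.isInternal.2 m
  induction x using DirectSum.induction_on with
  | zero => rwa [map_zero]
  | of j x => rw [DirectSum.coeAddMonoidHom_of]; exact homogeneous j _ x.2
  | add x y hx hy => rw [map_add]; exact add _ _ hx hy

/-- The additive map given by additive maps on the homogeneous components. -/
noncomputable def gradedLift {B : Type*} [AddCommGroup B] (φ : ℤ → M.carrier →+ B) :
    M.carrier →+ B :=
  (DirectSum.toAddMonoid fun j => (φ j).comp (M.deg j).subtype).comp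
    (AddEquiv.ofBijective (DirectSum.coeAddMonoidHom M.deg) M.isInternal).symm.toAddMonoidHom

variable {M}

theorem gradedLift_of_mem {B : Type*} [AddCommGroup B] (φ : ℤ → M.carrier →+ B) {j : ℤ}
    {m : M.carrier} (hm : m ∈ M.deg j) : M.gradedLift φ m = φ j m := by
  have : (AddEquiv.ofBijective (DirectSum.coeAddMonoidHom M.deg) M.isInternal).symm m =
      DirectSum.of (fun j => M.deg j) j ⟨m, hm⟩ := by
    rw [AddEquiv.symm_apply_eq]
    exact (DirectSum.coeAddMonoidHom_of M.deg j ⟨m, hm⟩).symm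
  simp [gradedLift, this]

variable (M) in
/-- The projection to a homogeneous component. -/
noncomputable def proj (i : ℤ) : M.carrier →+ M.carrier :=
  M.gradedLift fun j => if i = j then AddMonoidHom.id _ else 0

theorem proj_of_mem {j : ℤ} {m : M.carrier} (hm : m ∈ M.deg j) : M.proj j m = m := by
  rw [proj, gradedLift_of_mem _ hm, if_pos rfl, AddMonoidHom.id_apply]

theorem proj_of_mem_of_ne {i j : ℤ} {m : M.carrier} (hm : m ∈ M.deg j) (h : i ≠ j) :
    M.proj i m = 0 := by
  rw [proj, gradedLift_of_mem _ hm, if_neg h, AddMonoidHom.zero_apply]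

theorem proj_mem (i : ℤ) (m : M.carrier) : M.proj i m ∈ M.deg i := by
  induction m using M.induction_on with
  | zero => rw [map_zero]; exact zero_mem _
  | homogeneous j m hm =>
    by_cases h : i = j
    · subst h; rwa [proj_of_mem hm]
    · rw [proj_of_mem_of_ne hm h]; exact zero_mem _
  | add m n hm hn => rw [map_add]; exact add_mem hm hn

theorem exists_support (m : M.carrier) : ∃ s : Finset ℤ, ∀ j, j ∉ s → M.proj j m = 0 := by
  classical
  induction m using M.induction_on with
  | zero => exact ⟨∅, fun j _ => map_zero _⟩
  | homogeneous j m hm =>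
    exact ⟨{j}, fun i hi => proj_of_mem_of_ne hm (by simpa using hi)⟩
  | add m n hm hn =>
    obtain ⟨s, hs⟩ := hm
    obtain ⟨t, ht⟩ := hn
    refine ⟨s ∪ t, fun j hj => ?_⟩
    rw [Finset.mem_union, not_or] at hj
    rw [map_add, hs j hj.1, ht j hj.2, add_zero]

theorem sum_proj {m : M.carrier} {s : Finset ℤ} (hs : ∀ j, j ∉ s → M.proj j m = 0) :
    ∑ j ∈ s, M.proj j m = m := by
  -- Asking for all larger sets `t` makes the claim stable under addition of elements.
  have key : ∀ (m : M.carrier), ∃ s : Finset ℤ, ∀ t, s ⊆ t → ∑ j ∈ t, M.proj j m = m := by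
    classical
    intro m
    induction m using M.induction_on with
    | zero => exact ⟨∅, fun t _ => by simp⟩
    | homogeneous j m hm =>
      refine ⟨{j}, fun t ht => ?_⟩
      rw [Finset.sum_eq_single j, proj_of_mem hm]
      · exact fun i _ hi => proj_of_mem_of_ne hm hi
      · exact fun hj => absurd (ht (Finset.mem_singleton_self j)) hj
    | add m n hm hn =>
      obtain ⟨s, hs⟩ := hm
      obtain ⟨t, ht⟩ := hn
      refine ⟨s ∪ t, fun r hr => ?_⟩
      simp only [map_add]
      rw [Finset.sum_add_distrib, hs r (Finset.union_subset_left hr),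
        ht r (Finset.union_subset_right hr)]
  classical
  obtain ⟨t, ht⟩ := key m
  exact (Finset.sum_subset Finset.subset_union_left fun j _ hj => hs j hj).trans
    (ht (s ∪ t) Finset.subset_union_right)

theorem proj_smul {i : ℕ} {a : A} (ha : a ∈ 𝒜 i) (j : ℤ) (m : M.carrier) :
    M.proj (j + i) (MulOpposite.op a • m) = MulOpposite.op a • M.proj j m := by
  induction m using M.induction_on with
  | zero => simp
  | homogeneous l m hm =>
    by_cases h : j = l
    · subst h
      rw [proj_of_mem hm, proj_of_mem (M.smul_mem ha hm)]
    · rw [proj_of_mem_of_ne hm h, smul_zero,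
        proj_of_mem_of_ne (M.smul_mem ha hm) fun h' => h (by omega)]
  | add m n hm hn => rw [smul_add, map_add, map_add, smul_add, hm, hn]

theorem proj_smul_zero {a : A} (ha : a ∈ 𝒜 0) (j : ℤ) (m : M.carrier) :
    M.proj j (MulOpposite.op a • m) = MulOpposite.op a • M.proj j m := by
  simpa using proj_smul ha j m

/-- A submodule stable under taking homogeneous components, as a graded module. -/
noncomputable def ofSubmodule (M : GrModule.{u, v, w} 𝒜) (S : Submodule Aᵐᵒᵖ M.carrier)
    (hS : ∀ m ∈ S, ∀ j, M.proj j m ∈ S) : GrModule.{u, v, w} 𝒜 where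
  carrier := S
  deg j := (M.deg j).comap S.toAddSubgroup.subtype
  isInternal := by
    let π (j : ℤ) : S →+ S :=
      { toFun m := ⟨M.proj j m.1, hS _ m.2 j⟩
        map_zero' := Subtype.ext (map_zero _)
        map_add' m n := Subtype.ext (map_add (M.proj j) m.1 n.1) }
    refine DirectSum.isInternal_of_projections _ π
      (fun j m hm => Subtype.ext (proj_of_mem (M := M) hm))
      (fun i j h m hm => Subtype.ext (proj_of_mem_of_ne (M := M) hm (Ne.symm h))) fun m => ?_
    obtain ⟨s, hs⟩ := exists_support (M := M) m.1
    refine ⟨s, fun j => π j m, fun j => proj_mem (M := M) j m.1, Subtype.ext ?_⟩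
    rw [AddSubmonoidClass.coe_finsetSum]
    exact (sum_proj (M := M) hs).symm
  smul_mem ha hm := M.smul_mem ha hm

namespace ofSubmodule

variable {M N : GrModule.{u, v, w} 𝒜} {S : Submodule Aᵐᵒᵖ M.carrier}
  (hS : ∀ m ∈ S, ∀ j, M.proj j m ∈ S) {T : Submodule Aᵐᵒᵖ N.carrier}
  (hT : ∀ m ∈ T, ∀ j, N.proj j m ∈ T)

/-- The inclusion of a graded submodule. -/
noncomputable def incl : M.ofSubmodule S hS ⟶ M where
  toLinearMap := S.subtype
  map_deg _ _ hm := hm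

theorem incl_injective : Function.Injective (Hom.toLinearMap (incl hS)) := S.injective_subtype

theorem range_incl : LinearMap.range (Hom.toLinearMap (incl hS)) = S := S.range_subtype

theorem incl_mem (m : (M.ofSubmodule S hS).carrier) : Hom.toLinearMap (incl hS) m ∈ S :=
  Subtype.property (p := (· ∈ S)) m

theorem exists_incl_eq {j : ℤ} {m : M.carrier} (hm : m ∈ M.deg j) (hmS : m ∈ S) :
    ∃ y ∈ (M.ofSubmodule S hS).deg j, Hom.toLinearMap (incl hS) y = m :=
  ⟨⟨m, hmS⟩, hm, rfl⟩

/-- The restriction of a homomorphism to graded submodules. -/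
noncomputable def map (f : M ⟶ N) (hf : ∀ m ∈ S, Hom.toLinearMap f m ∈ T) :
    M.ofSubmodule S hS ⟶ N.ofSubmodule T hT where
  toLinearMap := (Hom.toLinearMap f).restrict hf
  map_deg j m hm := Hom.map_deg f j m.1 hm

end ofSubmodule

end GrModule

/-! ### Torsion elements -/

section Torsion

variable {k : Type u} [Field k] {A : Type v} [Ring A] [Algebra k A] (𝒜 : ℕ → Submodule k A)
  {M : Type*} [AddCommGroup M] [Module Aᵐᵒᵖ M]

/-- An element `m` is torsion modulo a submodule `S` if `m A_{≥ n} ⊆ S` for some `n`. -/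
def IsTorsionModulo (S : Submodule Aᵐᵒᵖ M) (m : M) : Prop :=
  ∃ n : ℕ, ∀ i, n ≤ i → ∀ a ∈ 𝒜 i, MulOpposite.op a • m ∈ S

variable {𝒜}

theorem IsTorsionModulo.zero (S : Submodule Aᵐᵒᵖ M) : IsTorsionModulo 𝒜 S 0 :=
  ⟨0, fun i _ a _ => by rw [smul_zero]; exact zero_mem _⟩

theorem IsTorsionModulo.add {S : Submodule Aᵐᵒᵖ M} {m n : M} (hm : IsTorsionModulo 𝒜 S m)
    (hn : IsTorsionModulo 𝒜 S n) : IsTorsionModulo 𝒜 S (m + n) := by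
  obtain ⟨a, ha⟩ := hm
  obtain ⟨b, hb⟩ := hn
  refine ⟨max a b, fun i hi c hc => ?_⟩
  rw [smul_add]
  exact add_mem (ha i ((le_max_left _ _).trans hi) c hc) (hb i ((le_max_right _ _).trans hi) c hc)

theorem IsTorsionModulo.sum {S : Submodule Aᵐᵒᵖ M} {ι : Type*} (s : Finset ι) {f : ι → M}
    (hf : ∀ i ∈ s, IsTorsionModulo 𝒜 S (f i)) : IsTorsionModulo 𝒜 S (∑ i ∈ s, f i) :=
  Finset.sum_induction _ _ (fun _ _ => .add) (.zero S) hf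

theorem isTorsionModule_submodule_iff {S : Submodule Aᵐᵒᵖ M} :
    IsTorsionModule 𝒜 S ↔ ∀ m ∈ S, IsTorsionModulo 𝒜 ⊥ m := by
  simp only [IsTorsionModule, IsTorsionModulo, Submodule.mem_bot, Subtype.forall,
    Subtype.ext_iff, Submodule.coe_smul, ZeroMemClass.coe_zero]

theorem isTorsionModule_quotient_iff {S : Submodule Aᵐᵒᵖ M} :
    IsTorsionModule 𝒜 (M ⧸ S) ↔ ∀ m, IsTorsionModulo 𝒜 S m := by
  rw [IsTorsionModule, (Submodule.mkQ_surjective S).forall]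
  simp only [IsTorsionModulo, Submodule.mkQ_apply,
    ← Submodule.Quotient.mk_smul, Submodule.Quotient.mk_eq_zero]

end Torsion

/-! ### The stable fibre of a graded module -/

namespace PathAlgebra

open MulOpposite

variable {k : Type u} [Field k] {V : Type v} [Quiver.{e} V] [Fintype V] (h : HasIsolatedCycles V)

/-- The category of graded right modules over the path algebra. -/
abbrev GrMod (k : Type u) [Field k] (V : Type v) [Quiver.{e} V] [Fintype V] :
    Type (max u v e (w + 1)) :=
  GrModule.{u, max u v e, w} (grading k V)

/-- The additive subgroup of the elements `m - m x`, where `x` is the sum of the arrows between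
cyclic vertices. -/
noncomputable def stableRelations (M : GrMod.{u, v, e, w} k V) : AddSubgroup M.carrier :=
  (AddMonoidHom.id M.carrier -
    DistribSMul.toAddMonoidHom M.carrier (op (cycleElt k V))).range

/-- The direct limit of the homogeneous components along multiplication by the sum of the arrows
between cyclic vertices, as a quotient of the module. -/
def StableFibre (_ : HasIsolatedCycles V) (M : GrMod.{u, v, e, w} k V) : Type w :=
  M.carrier ⧸ stableRelations M

namespace StableFibre

variable {h} {M N : GrMod.{u, v, e, w} k V}

noncomputable instance : AddCommGroup (StableFibre h M) :=
  inferInstanceAs (AddCommGroup (M.carrier ⧸ stableRelations M))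

variable (h M) in
/-- The class of an element of the module in the stable fibre. -/
noncomputable def mk : M.carrier →+ StableFibre h M := QuotientAddGroup.mk' (stableRelations M)

theorem mk_surjective : Function.Surjective (mk h M) := QuotientAddGroup.mk'_surjective _

theorem mk_eq_zero_iff {m : M.carrier} :
    mk h M m = 0 ↔ ∃ y, y - op (cycleElt k V) • y = m :=
  QuotientAddGroup.eq_zero_iff m

theorem mk_cycleElt_smul (m : M.carrier) : mk h M (op (cycleElt k V) • m) = mk h M m := by
  rw [eq_comm, ← sub_eq_zero, ← map_sub, mk_eq_zero_iff]
  exact ⟨m, rfl⟩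

theorem mk_cycleElt_pow_smul (n : ℕ) (m : M.carrier) :
    mk h M (op (cycleElt k V ^ n) • m) = mk h M m := by
  induction n with
  | zero => rw [pow_zero, op_one, one_smul]
  | succ n ih => rw [pow_succ, op_mul, mul_smul, mk_cycleElt_smul, ih]

theorem mk_eq_zero_of_cycleElt_smul {m : M.carrier} (hm : op (cycleElt k V) • m = 0) :
    mk h M m = 0 := by
  rw [← mk_cycleElt_smul, hm, map_zero]

variable (h M) in
/-- The action of a function on the cyclic vertices on a graded module. -/
noncomputable def twist (r : CyclicVertex V → k) : M.carrier →+ M.carrier :=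
  M.gradedLift fun j => DistribSMul.toAddMonoidHom M.carrier (op (rotate h j r))

theorem twist_of_mem (r : CyclicVertex V → k) {j : ℤ} {m : M.carrier} (hm : m ∈ M.deg j) :
    twist h M r m = op (rotate h j r) • m :=
  GrModule.gradedLift_of_mem _ hm

theorem rotate_smul_mem (r : CyclicVertex V → k) {j : ℤ} {m : M.carrier} (hm : m ∈ M.deg j) :
    op (rotate h j r) • m ∈ M.deg j := by
  simpa using M.smul_mem (rotate_mem_grading h j r) hm

theorem cycleElt_smul_mem {j : ℤ} {m : M.carrier} (hm : m ∈ M.deg j) :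
    op (cycleElt k V) • m ∈ M.deg (j + 1) := by
  simpa using M.smul_mem (cycleElt_mem_grading (k := k) (V := V)) hm

theorem twist_cycleElt_smul (r : CyclicVertex V → k) (m : M.carrier) :
    twist h M r (op (cycleElt k V) • m) = op (cycleElt k V) • twist h M r m := by
  induction m using M.induction_on with
  | zero => simp
  | homogeneous j m hm =>
    rw [twist_of_mem r hm, twist_of_mem r (cycleElt_smul_mem hm), smul_smul, smul_smul, ← op_mul,
      ← op_mul, rotate_mul_cycleElt]
  | add m n hm hn => simp only [smul_add, map_add, hm, hn]

theorem stableRelations_le_comap_twist (r : CyclicVertex V → k) :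
    stableRelations M ≤ (stableRelations M).comap (twist h M r) := by
  rintro _ ⟨y, rfl⟩
  refine ⟨twist h M r y, ?_⟩
  simp [twist_cycleElt_smul]

noncomputable instance : SMul (CyclicVertex V → k) (StableFibre h M) where
  smul r := QuotientAddGroup.map _ _ (twist h M r) (stableRelations_le_comap_twist r)

theorem smul_mk (r : CyclicVertex V → k) (m : M.carrier) :
    r • mk h M m = mk h M (twist h M r m) := rfl

theorem smul_mk_of_mem (r : CyclicVertex V → k) {j : ℤ} {m : M.carrier} (hm : m ∈ M.deg j) :
    r • mk h M m = mk h M (op (rotate h j r) • m) := by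
  rw [smul_mk, twist_of_mem r hm]

theorem smul_add' (r : CyclicVertex V → k) (y z : StableFibre h M) :
    r • (y + z) = r • y + r • z :=
  map_add (QuotientAddGroup.map _ _ (twist h M r) (stableRelations_le_comap_twist r)) y z

theorem smul_zero' (r : CyclicVertex V → k) : r • (0 : StableFibre h M) = 0 :=
  map_zero (QuotientAddGroup.map _ _ (twist h M r) (stableRelations_le_comap_twist r))

theorem induction_on {P : StableFibre h M → Prop} (z : StableFibre h M) (zero : P 0)
    (homogeneous : ∀ j, ∀ m ∈ M.deg j, P (mk h M m)) (add : ∀ y z, P y → P z → P (y + z)) :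
    P z := by
  obtain ⟨m, rfl⟩ := mk_surjective z
  induction m using M.induction_on with
  | zero => rwa [map_zero]
  | homogeneous j m hm => exact homogeneous j m hm
  | add m n hm hn => rw [map_add]; exact add _ _ hm hn

noncomputable instance : Module (CyclicVertex V → k) (StableFibre h M) where
  one_smul z := by
    induction z using induction_on with
    | zero => exact smul_zero' _
    | homogeneous j m hm =>
      -- The constant function `1` acts by the sum of the cyclic idempotents, which need not be `1`;
      -- it fixes `cycleElt` on the left, and `cycleElt` acts as the identity on classes.
      rw [smul_mk_of_mem _ hm, ← mk_cycleElt_smul, smul_smul, ← op_mul, rotate_one_mul_cycleElt,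
        mk_cycleElt_smul]
    | add y z hy hz => rw [smul_add', hy, hz]
  mul_smul r s z := by
    induction z using induction_on with
    | zero => simp only [smul_zero']
    | homogeneous j m hm =>
      rw [smul_mk_of_mem _ hm, smul_mk_of_mem _ hm, smul_mk_of_mem _ (rotate_smul_mem s hm),
        smul_smul, ← op_mul, ← rotate_mul, mul_comm]
    | add y z hy hz => simp only [smul_add', hy, hz]
  smul_zero := smul_zero'
  smul_add := smul_add'
  add_smul r s z := by
    induction z using induction_on with
    | zero => simp only [smul_zero', add_zero]
    | homogeneous j m hm =>
      rw [smul_mk_of_mem _ hm, smul_mk_of_mem _ hm, smul_mk_of_mem _ hm, rotate_add, MulOpposite.op_add,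
        add_smul, map_add]
    | add y z hy hz => simp only [smul_add', hy, hz]; abel
  zero_smul z := by
    induction z using induction_on with
    | zero => exact smul_zero' _
    | homogeneous j m hm => rw [smul_mk_of_mem _ hm, rotate_zero, op_zero, zero_smul, map_zero]
    | add y z hy hz => rw [smul_add', hy, hz, add_zero]

variable (h) in
/-- The additive map of stable fibres induced by a homomorphism of graded modules. -/
noncomputable def mapAdd (f : M ⟶ N) : StableFibre h M →+ StableFibre h N :=
  QuotientAddGroup.map (stableRelations M) (stableRelations N)
    (GrModule.Hom.toLinearMap f).toAddMonoidHom (by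
      rintro _ ⟨y, rfl⟩
      exact ⟨GrModule.Hom.toLinearMap f y, by simp⟩)

theorem mapAdd_mk (f : M ⟶ N) (m : M.carrier) :
    mapAdd h f (mk h M m) = mk h N (GrModule.Hom.toLinearMap f m) := rfl

variable (h) in
/-- The map of stable fibres induced by a homomorphism of graded modules. -/
noncomputable def map (f : M ⟶ N) : StableFibre h M →ₗ[CyclicVertex V → k] StableFibre h N where
  __ := mapAdd h f
  map_smul' r z := by
    change mapAdd h f (r • z) = r • mapAdd h f z
    induction z using induction_on with
    | zero => simp
    | homogeneous j m hm =>
      rw [smul_mk_of_mem _ hm, mapAdd_mk, mapAdd_mk,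
        smul_mk_of_mem r (GrModule.Hom.map_deg f _ _ hm), map_smul]
    | add y z hy hz => simp only [smul_add, map_add, hy, hz]

theorem map_mk (f : M ⟶ N) (m : M.carrier) :
    map h f (mk h M m) = mk h N (GrModule.Hom.toLinearMap f m) := rfl

/-- Every element of the stable fibre is represented in all sufficiently large degrees. -/
theorem exists_mk_eq (z : StableFibre h M) :
    ∃ l : ℤ, ∀ j, l ≤ j → ∃ m ∈ M.deg j, mk h M m = z := by
  induction z using induction_on with
  | zero => exact ⟨0, fun j _ => ⟨0, zero_mem _, map_zero _⟩⟩
  | homogeneous j m hm =>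
    refine ⟨j, fun i hi => ⟨op (cycleElt k V ^ (i - j).toNat) • m, ?_, mk_cycleElt_pow_smul _ _⟩⟩
    have := M.smul_mem (cycleElt_pow_mem_grading (k := k) (V := V) (i - j).toNat) hm
    rwa [show j + ((i - j).toNat : ℤ) = i by omega] at this
  | add y z hy hz =>
    obtain ⟨a, ha⟩ := hy
    obtain ⟨b, hb⟩ := hz
    refine ⟨max a b, fun j hj => ?_⟩
    obtain ⟨m, hm, rfl⟩ := ha j ((le_max_left _ _).trans hj)
    obtain ⟨n, hn, rfl⟩ := hb j ((le_max_right _ _).trans hj)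
    exact ⟨m + n, add_mem hm hn, map_add _ _ _⟩

/-- A homogeneous element vanishes in the stable fibre only if it is annihilated by a power of
the sum of the arrows between cyclic vertices. -/
theorem exists_pow_smul_eq_zero {j : ℤ} {m : M.carrier} (hm : m ∈ M.deg j)
    (h0 : mk h M m = 0) : ∃ n, op (cycleElt k V ^ n) • m = 0 := by
  obtain ⟨y, hy⟩ := mk_eq_zero_iff.1 h0
  obtain ⟨s, hs⟩ := M.exists_support y
  -- The relation `m = y - y x`, read in degree `i + 1`. Starting below the support of `y`, it gives
  -- `0` in degrees below `j`, then `m` in degree `j`, then `m xⁿ` in degree `j + n`; the last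
  -- vanishes beyond the support.
  have hstep (i : ℤ) : M.proj (i + 1) y = op (cycleElt k V) • M.proj i y + M.proj (i + 1) m := by
    have := GrModule.proj_smul (cycleElt_mem_grading (k := k) (V := V)) i y
    rw [Nat.cast_one] at this
    rw [← this, ← hy, map_sub, add_sub_cancel]
  obtain ⟨lo, hlo⟩ : ∃ lo, ∀ i ∈ s, lo < i := by
    obtain ⟨b, hb⟩ := s.bddBelow
    exact ⟨b - 1, fun i hi => by have := hb hi; omega⟩
  obtain ⟨hi, hhi⟩ : ∃ hi, ∀ i ∈ s, i < hi := by
    obtain ⟨b, hb⟩ := s.bddAbove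
    exact ⟨b + 1, fun i hi => by have := hb hi; omega⟩
  have hzero (n : ℕ) : ∀ i : ℤ, i ≤ lo + n → i < j → M.proj i y = 0 := by
    induction n with
    | zero =>
      intro i hi _
      exact hs i fun his => by have := hlo i his; omega
    | succ n ih =>
      intro i hi hij
      have := hstep (i - 1)
      rw [sub_add_cancel, ih (i - 1) (by push_cast at hi; omega) (by omega), smul_zero, zero_add,
        GrModule.proj_of_mem_of_ne hm hij.ne] at this
      exact this
  have hpow (n : ℕ) : M.proj (j + n) y = op (cycleElt k V ^ n) • m := by
    induction n with
    | zero =>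
      have := hstep (j - 1)
      rw [sub_add_cancel, hzero (j - 1 - lo).toNat (j - 1) (by omega) (by omega), smul_zero,
        zero_add, GrModule.proj_of_mem hm] at this
      simpa using this
    | succ n ih =>
      have := hstep (j + n)
      rw [GrModule.proj_of_mem_of_ne hm (by omega), add_zero, ih, smul_smul, ← op_mul, ← pow_succ,
        add_assoc] at this
      exact_mod_cast this
  refine ⟨(hi - j).toNat, ?_⟩
  rw [← hpow]
  exact hs _ fun his => by have := hhi _ his; omega

/-- Powers of `cycleElt` do not change classes. A high power carries any element of the kernel to
zero and any element of the target into the range. -/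
theorem map_bijective_of_torsionIso {f : M ⟶ N} (hf : torsionIso (grading k V) f) :
    Function.Bijective (map h f) := by
  constructor
  · rw [injective_iff_map_eq_zero]
    intro z hz
    obtain ⟨l, hl⟩ := exists_mk_eq z
    obtain ⟨m, hm, rfl⟩ := hl l le_rfl
    rw [map_mk] at hz
    obtain ⟨n, hn⟩ := exists_pow_smul_eq_zero (GrModule.Hom.map_deg f _ _ hm) hz
    rw [← map_smul] at hn
    obtain ⟨n', hn'⟩ := isTorsionModule_submodule_iff.1 hf.1 _ (LinearMap.mem_ker.2 hn)
    rw [← mk_cycleElt_pow_smul n, ← mk_cycleElt_pow_smul n',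
      ((Submodule.mem_bot _).1 (hn' n' le_rfl _ (cycleElt_pow_mem_grading n'))), map_zero]
  · intro z
    obtain ⟨m, rfl⟩ := mk_surjective z
    obtain ⟨n, hn⟩ := isTorsionModule_quotient_iff.1 hf.2 m
    obtain ⟨y, hy⟩ := hn n le_rfl _ (cycleElt_pow_mem_grading n)
    exact ⟨mk h M y, by rw [map_mk, hy, mk_cycleElt_pow_smul]⟩

end StableFibre

/-- The stable fibre, as a functor. -/
noncomputable def stableFibreFunctor :
    GrMod.{u, v, e, w} k V ⥤ ModuleCat.{w} (CyclicVertex V → k) where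
  obj M := ModuleCat.of _ (StableFibre h M)
  map f := ModuleCat.ofHom (StableFibre.map h f)
  map_id M := by
    ext z
    obtain ⟨m, rfl⟩ := StableFibre.mk_surjective (h := h) z
    rfl
  map_comp f g := by
    ext z
    obtain ⟨m, rfl⟩ := StableFibre.mk_surjective (h := h) z
    rfl

theorem stableFibreFunctor_inverts :
    (torsionIso.{u, max u v e, w} (grading k V)).IsInvertedBy (stableFibreFunctor h) :=
  fun _ _ _ hf => (ConcreteCategory.isIso_iff_bijective _).2
    (StableFibre.map_bijective_of_torsionIso hf)

end PathAlgebra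

/-! ### Periodic graded modules -/

theorem HasIsolatedCycles.perm_pow_length {V : Type v} [Quiver.{e} V] [Finite V]
    (h : HasIsolatedCycles V) {a b : V} (p : Quiver.Path a b) (ha : IsCyclicVertex a)
    (hb : IsCyclicVertex b) : (h.perm ^ p.length) ⟨a, ha⟩ = ⟨b, hb⟩ := by
  induction p with
  | nil => rfl
  | @cons y z p f ih =>
    have hy : IsCyclicVertex y := h.isCyclicVertex_of_between p f.toPath ha hb
    rw [Quiver.Path.length_cons, pow_succ', Equiv.Perm.mul_apply, ih hy]
    exact Subtype.ext (congrArg Sigma.fst (h.arrow_eq_nextArrow ⟨y, hy⟩ ⟨z, hb⟩ f)).symm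

/-- The coordinate of `N` attached to the source of a path in degree `j` is the one attached to its
target in degree `j` plus the length. -/
theorem HasIsolatedCycles.perm_zpow_neg_add_length {V : Type v} [Quiver.{e} V] [Finite V]
    (h : HasIsolatedCycles V) {a b : V} (p : Quiver.Path a b) (ha : IsCyclicVertex a)
    (hb : IsCyclicVertex b) (j : ℤ) :
    (h.perm ^ (-(j + p.length))) ⟨b, hb⟩ = (h.perm ^ (-j)) ⟨a, ha⟩ := by
  rw [← h.perm_pow_length p ha hb, ← zpow_natCast, ← Equiv.Perm.mul_apply, ← zpow_add]
  congr 2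
  ring

namespace PathAlgebra

open MulOpposite
open Quiver (Path)

variable {k : Type u} [Field k] {V : Type v} [Quiver.{e} V] [Fintype V] (h : HasIsolatedCycles V)
  {N : Type w} [AddCommGroup N] [Module (CyclicVertex V → k) N]

open Classical in
variable (k N) in
/-- The action of a path on `N[ℤ]`. -/
noncomputable def pathAct (p : QuiverPath V) : Module.End (CyclicVertex V → k) (ℤ →₀ N) :=
  if hc : IsCyclicVertex p.1 ∧ IsCyclicVertex p.2.1 then
    Finsupp.lsum (CyclicVertex V → k) fun j => (Finsupp.lsingle (j + p.2.2.length)).comp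
      (LinearMap.lsmul (CyclicVertex V → k) N (Pi.single ((h.perm ^ (-j)) ⟨p.1, hc.1⟩) 1))
  else 0

open Classical in
theorem pathAct_single {a b : V} (p : Path a b) (ha : IsCyclicVertex a) (hb : IsCyclicVertex b)
    (j : ℤ) (n : N) : pathAct k h N ⟨a, b, p⟩ (Finsupp.single j n) =
      Finsupp.single (j + p.length)
        ((Pi.single ((h.perm ^ (-j)) ⟨a, ha⟩) 1 : CyclicVertex V → k) • n) := by
  rw [pathAct, dif_pos ⟨ha, hb⟩]
  simp

theorem pathAct_of_not {a b : V} (p : Path a b) (hc : ¬ (IsCyclicVertex a ∧ IsCyclicVertex b)) :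
    pathAct k h N ⟨a, b, p⟩ = 0 :=
  dif_neg hc

/-- If `a` and `c` are cyclic then so is `b`, and both factors project to the same coordinate of
`N`; otherwise both sides vanish. The factors are reversed because right modules are encoded over
the opposite ring. -/
theorem pathAct_comp {a b c : V} (p : Path a b) (q : Path b c) :
    pathAct k h N ⟨a, c, p.comp q⟩ = pathAct k h N ⟨b, c, q⟩ * pathAct k h N ⟨a, b, p⟩ := by
  classical
  by_cases hac : IsCyclicVertex a ∧ IsCyclicVertex c
  · obtain ⟨ha, hc⟩ := hac
    have hb := h.isCyclicVertex_of_between p q ha hc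
    refine Finsupp.lhom_ext fun j n => ?_
    rw [Module.End.mul_apply, pathAct_single h p ha hb, pathAct_single h q hb hc,
      pathAct_single h _ ha hc, h.perm_zpow_neg_add_length p ha hb, smul_smul, Path.length_comp,
      ← Pi.single_mul, one_mul, Nat.cast_add, add_assoc]
  · rw [pathAct_of_not h _ hac]
    rw [not_and_or] at hac
    rcases hac with ha | hc
    · rw [pathAct_of_not h p fun h' => ha h'.1, mul_zero]
    · rw [pathAct_of_not h q fun h' => hc h'.2, zero_mul]

/-- In the degree reached by `p`, distinct vertices belong to distinct coordinates, whose
projections are orthogonal. -/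
theorem pathAct_mul_of_ne {a b b' c : V} (p : Path a b) (q : Path b' c) (hne : b ≠ b') :
    pathAct k h N ⟨b', c, q⟩ * pathAct k h N ⟨a, b, p⟩ = 0 := by
  classical
  by_cases hab : IsCyclicVertex a ∧ IsCyclicVertex b
  · by_cases hbc : IsCyclicVertex b' ∧ IsCyclicVertex c
    · refine Finsupp.lhom_ext fun j n => ?_
      rw [Module.End.mul_apply, pathAct_single h p hab.1 hab.2, pathAct_single h q hbc.1 hbc.2,
        ← h.perm_zpow_neg_add_length p hab.1 hab.2, smul_smul, LinearMap.zero_apply]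
      have : (Pi.single ((h.perm ^ (-(j + p.length))) ⟨b', hbc.1⟩) 1 *
          Pi.single ((h.perm ^ (-(j + p.length))) ⟨b, hab.2⟩) 1 : CyclicVertex V → k) = 0 := by
        ext d
        simp only [Pi.mul_apply, Pi.single_apply, Pi.zero_apply, mul_ite, mul_one, mul_zero]
        split_ifs with h₁ h₂
        · exact absurd (congrArg Subtype.val ((h.perm ^ (-(j + (p.length : ℤ)))).injective
            (h₁.symm.trans h₂))) hne
        all_goals rfl
      rw [this, zero_smul, Finsupp.single_zero]
    · rw [pathAct_of_not h q hbc, zero_mul]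
  · rw [pathAct_of_not h p hab, mul_zero]

variable (N) in
/-- The action of the path algebra on `N[ℤ]`. -/
noncomputable def actHom : PathAlgebra k V →+ Module.End (CyclicVertex V → k) (ℤ →₀ N) :=
  Finsupp.liftAddHom fun p =>
    -- `N` carries no separate `k`-structure, so scalars act through constant functions and the map
    -- is only built as an additive one.
    ((smulAddHom (CyclicVertex V → k) _).flip (pathAct k h N p)).comp
      (algebraMap k (CyclicVertex V → k)).toAddMonoidHom

theorem actHom_smul_ofPath (c : k) (p : QuiverPath V) :
    actHom h N (c • ofPath k p) = algebraMap k (CyclicVertex V → k) c • pathAct k h N p := by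
  have : c • ofPath k p = (Finsupp.single p c : QuiverPath V →₀ k) := by
    change c • (Finsupp.single p 1 : QuiverPath V →₀ k) = _
    rw [Finsupp.smul_single, smul_eq_mul, mul_one]
  rw [this]
  exact Finsupp.liftAddHom_apply_single _ _ _

theorem actHom_ofPath (p : QuiverPath V) : actHom h N (ofPath k p) = pathAct k h N p := by
  simpa using actHom_smul_ofPath h (N := N) (1 : k) p

theorem actHom_smul (c : k) (a : PathAlgebra k V) :
    actHom h N (c • a) = algebraMap k (CyclicVertex V → k) c • actHom h N a := by
  induction a using induction_on with
  | zero => simp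
  | add x y hx hy => rw [smul_add, map_add, map_add, smul_add, hx, hy]
  | smul d p => rw [smul_smul, actHom_smul_ofPath, actHom_smul_ofPath, smul_smul, map_mul]

theorem actHom_mul (a b : PathAlgebra k V) :
    actHom h N (a * b) = actHom h N b * actHom h N a := by
  induction a using induction_on with
  | zero => simp
  | add x y hx hy => rw [add_mul, map_add, map_add, mul_add, hx, hy]
  | smul c p =>
    induction b using induction_on with
    | zero => simp
    | add x y hx hy => rw [mul_add, map_add, map_add, add_mul, hx, hy]
    | smul d q =>
      rw [smul_mul_assoc, mul_smul_comm, actHom_smul, actHom_smul, actHom_smul, actHom_smul,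
        smul_mul_assoc, mul_smul_comm, smul_comm]
      congr 2
      obtain ⟨a, b, p⟩ := p
      obtain ⟨b', c, q⟩ := q
      by_cases hb : b = b'
      · subst hb
        rw [ofPath_mul_ofPath_of_eq, actHom_ofPath, actHom_ofPath, actHom_ofPath, pathAct_comp]
      · rw [ofPath_mul_ofPath_of_ne _ _ hb, actHom_ofPath, actHom_ofPath, map_zero,
          pathAct_mul_of_ne h p q hb]

theorem actHom_idem_of_not {a : V} (ha : ¬ IsCyclicVertex a) : actHom h N (idem k a) = 0 := by
  rw [idem, actHom_ofPath, pathAct_of_not h _ fun h' => ha h'.1]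

open Classical in
theorem actHom_idem_single (c : CyclicVertex V) (j : ℤ) (n : N) :
    actHom h N (idem k c.1) (Finsupp.single j n) =
      Finsupp.single j ((Pi.single ((h.perm ^ (-j)) c) 1 : CyclicVertex V → k) • n) := by
  rw [idem, actHom_ofPath, pathAct_single h _ c.2 c.2]
  simp

theorem sum_actHom_idem_single (r : CyclicVertex V → k) (j : ℤ) (n : N) :
    ∑ c : CyclicVertex V, actHom h N (r ((h.perm ^ (-j)) c) • idem k c.1) (Finsupp.single j n) =
      Finsupp.single j (r • n) := by
  classical
  have hr : r = ∑ c : CyclicVertex V, algebraMap k (CyclicVertex V → k) (r ((h.perm ^ (-j)) c)) *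
      Pi.single ((h.perm ^ (-j)) c) 1 := by
    refine Eq.trans ?_ (Fintype.sum_equiv (h.perm ^ (-j)) _ (fun c =>
      (algebraMap k (CyclicVertex V → k) (r c) * Pi.single c 1 : CyclicVertex V → k))
      fun c => rfl).symm
    ext d
    simp [Pi.single_apply]
  conv_rhs => rw [hr, Finset.sum_smul, Finsupp.single_finsetSum]
  refine Finset.sum_congr rfl fun c _ => ?_
  rw [actHom_smul, LinearMap.smul_apply, actHom_idem_single, Finsupp.smul_single, smul_smul]

theorem actHom_rotate_single (r : CyclicVertex V → k) (j : ℤ) (n : N) :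
    actHom h N (rotate h j r) (Finsupp.single j n) = Finsupp.single j (r • n) := by
  rw [rotate, map_sum, LinearMap.sum_apply, sum_actHom_idem_single]

/-- Non-cyclic idempotents act by zero; in each degree the cyclic ones are the coordinate
projections in permuted order, and these sum to the identity. -/
theorem actHom_one : actHom h N (1 : PathAlgebra k V) = 1 := by
  classical
  refine Finsupp.lhom_ext fun j n => ?_
  have hone : (1 : PathAlgebra k V) = ∑ a : V, idem k a := rfl
  have hz : ∑ a : {a : V // ¬ IsCyclicVertex a}, actHom h N (idem k a.1) = 0 :=
    Finset.sum_eq_zero fun a _ => actHom_idem_of_not h a.2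
  rw [hone, map_sum, ← Fintype.sum_subtype_add_sum_subtype IsCyclicVertex, hz, add_zero,
    LinearMap.sum_apply, Module.End.one_apply]
  have := sum_actHom_idem_single h (1 : CyclicVertex V → k) j n
  simp only [Pi.one_apply, one_smul] at this
  refine Eq.trans ?_ this
  exact Finset.sum_congr (by ext; simp) fun _ _ => rfl

theorem actHom_cycleElt_single (j : ℤ) (n : N) :
    actHom h N (cycleElt k V) (Finsupp.single j n) = Finsupp.single (j + 1) n := by
  classical
  have hsum : ∀ c : CyclicVertex V,
      actHom h N (ofPath k ⟨c.1, c.next.1, c.nextArrow.toPath⟩) (Finsupp.single j n) =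
      Finsupp.single (j + 1) ((Pi.single ((h.perm ^ (-j)) c) 1 : CyclicVertex V → k) • n) :=
    fun c => by rw [actHom_ofPath, pathAct_single h _ c.2 c.next.2]; simp
  rw [cycleElt, map_sum, LinearMap.sum_apply, Finset.sum_congr rfl fun c _ => hsum c,
    ← Finsupp.single_finsetSum, ← Finset.sum_smul,
    Equiv.sum_comp (h.perm ^ (-j)) fun c => (Pi.single c 1 : CyclicVertex V → k),
    show (∑ c : CyclicVertex V, Pi.single c 1 : CyclicVertex V → k) = 1 from
      Finset.univ_sum_single 1, one_smul]

theorem mapRange_actHom {N' : Type w} [AddCommGroup N'] [Module (CyclicVertex V → k) N']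
    (f : N →ₗ[CyclicVertex V → k] N') (a : PathAlgebra k V) :
    Finsupp.mapRange.linearMap f ∘ₗ actHom h N a =
      actHom h N' a ∘ₗ Finsupp.mapRange.linearMap f := by
  classical
  refine Finsupp.lhom_ext fun j n => ?_
  simp only [LinearMap.comp_apply]
  induction a using induction_on with
  | zero => simp
  | add x y hx hy => simp only [map_add, LinearMap.add_apply, hx, hy]
  | smul c p =>
    obtain ⟨a, b, p⟩ := p
    rw [actHom_smul_ofPath, actHom_smul_ofPath, LinearMap.smul_apply, LinearMap.smul_apply,
      map_smul]
    congr 1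
    by_cases hc : IsCyclicVertex a ∧ IsCyclicVertex b
    · rw [pathAct_single h p hc.1 hc.2, Finsupp.mapRange.linearMap_apply,
        Finsupp.mapRange.linearMap_apply, Finsupp.mapRange_single, Finsupp.mapRange_single,
        pathAct_single h p hc.1 hc.2, map_smul]
    · rw [pathAct_of_not h p hc, pathAct_of_not h p hc, LinearMap.zero_apply,
        LinearMap.zero_apply, map_zero]

/-- The underlying type of the graded module with all components equal to `N`. -/
def Periodic (_ : HasIsolatedCycles V) (N : Type w) [AddCommGroup N] : Type w := ℤ →₀ N

noncomputable instance : AddCommGroup (Periodic h N) := inferInstanceAs (AddCommGroup (ℤ →₀ N))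

noncomputable instance : Module (PathAlgebra k V)ᵐᵒᵖ (Periodic h N) where
  smul a z := actHom h N a.unop z
  one_smul z := by change actHom h N (1 : PathAlgebra k V) z = z; rw [actHom_one]; rfl
  mul_smul a b z := by
    change actHom h N (b.unop * a.unop) z = actHom h N a.unop (actHom h N b.unop z)
    rw [actHom_mul]; rfl
  smul_zero a := map_zero (actHom h N a.unop)
  smul_add a := map_add (actHom h N a.unop)
  add_smul a b z := by
    change actHom h N (a.unop + b.unop) z = actHom h N a.unop z + actHom h N b.unop z
    rw [map_add]; rfl
  zero_smul z := by change actHom h N (0 : PathAlgebra k V) z = 0; rw [map_zero]; rfl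

namespace Periodic

/-- The element of degree `j` given by an element of `N`. -/
noncomputable def single (j : ℤ) : N →+ Periodic h N := Finsupp.singleAddHom j

/-- The coefficient in degree `j`. -/
noncomputable def coeff (j : ℤ) : Periodic h N →+ N := Finsupp.applyAddHom j

theorem smul_def (a : PathAlgebra k V) (z : Periodic h N) : op a • z = actHom h N a z := rfl

theorem ofPath_smul_of_not {a b : V} (p : Path a b)
    (hc : ¬ (IsCyclicVertex a ∧ IsCyclicVertex b)) (z : Periodic h N) :
    op (ofPath k ⟨a, b, p⟩) • z = 0 := by
  rw [smul_def, actHom_ofPath, pathAct_of_not h p hc]; rfl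

theorem cycleElt_smul_single (j : ℤ) (n : N) :
    op (cycleElt k V) • single h j n = single h (j + 1) n :=
  actHom_cycleElt_single h j n

theorem cycleElt_pow_smul_single (i : ℕ) (j : ℤ) (n : N) :
    op (cycleElt k V ^ i) • single h j n = single h (j + i) n := by
  induction i with
  | zero => simp
  | succ i ih =>
    rw [pow_succ, op_mul, mul_smul, ih, cycleElt_smul_single, Nat.cast_add, Nat.cast_one, add_assoc]

theorem rotate_smul_single (r : CyclicVertex V → k) (j : ℤ) (n : N) :
    op (rotate h j r) • single h j n = single h j (r • n) :=
  actHom_rotate_single h r j n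

theorem ofPath_smul_single_mem {a b : V} (p : Path a b) (j : ℤ) (n : N) :
    op (ofPath k ⟨a, b, p⟩) • single h j n ∈ (single h (N := N) (j + p.length)).range := by
  by_cases hc : IsCyclicVertex a ∧ IsCyclicVertex b
  · rw [smul_def, actHom_ofPath]
    exact ⟨_, (pathAct_single h p hc.1 hc.2 j n).symm⟩
  · rw [ofPath_smul_of_not h p hc]
    exact zero_mem _

end Periodic

variable (k) in
/-- The graded module with all components equal to `N`. -/
noncomputable def periodicModule (N : Type w) [AddCommGroup N] [Module (CyclicVertex V → k) N] :
    GrMod.{u, v, e, w} k V where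
  carrier := Periodic h N
  deg j := (Periodic.single h j).range
  isInternal := by
    refine DirectSum.isInternal_of_projections _
      (fun j => (Periodic.single h j).comp (Periodic.coeff h j)) ?_ ?_ fun z => ?_
    · rintro j _ ⟨n, rfl⟩
      exact congrArg (Periodic.single h j) Finsupp.single_eq_same
    · rintro i j hij _ ⟨n, rfl⟩
      exact (congrArg (Periodic.single h j) (Finsupp.single_eq_of_ne hij.symm)).trans (map_zero _)
    · exact ⟨Finsupp.support z, fun j => Periodic.single h j (Periodic.coeff h j z),
        fun j => ⟨_, rfl⟩, (Finsupp.sum_single z).symm⟩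
  smul_mem {i j a m} ha hm := by
    obtain ⟨n, rfl⟩ := hm
    induction ha using Submodule.span_induction with
    | zero => rw [op_zero, zero_smul]; exact zero_mem _
    | add x y _ _ hx hy => rw [MulOpposite.op_add, add_smul]; exact add_mem hx hy
    | smul c x _ hx =>
      obtain ⟨n', hn'⟩ := hx
      refine ⟨algebraMap k (CyclicVertex V → k) c • n', ?_⟩
      rw [Periodic.smul_def] at hn' ⊢
      refine Eq.trans ?_ (LinearMap.congr_fun (actHom_smul h c x) (Finsupp.single j n)).symm
      exact (Finsupp.smul_single _ _ _).symm.trans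
        (congrArg (algebraMap k (CyclicVertex V → k) c • · : (ℤ →₀ N) → (ℤ →₀ N)) hn')
    | mem x hx =>
      obtain ⟨⟨a, b, p⟩, rfl, rfl⟩ := hx
      exact Periodic.ofPath_smul_single_mem h p j n

namespace periodicModule

variable (k) in
/-- The element of degree `j` of the periodic module given by an element of `N`. -/
noncomputable def single (j : ℤ) : N →+ (periodicModule k h N).carrier := Periodic.single h j

variable (k) in
/-- The coefficient in degree `j` of an element of the periodic module. -/
noncomputable def coeff (j : ℤ) : (periodicModule k h N).carrier →+ N := Periodic.coeff h j

variable (k N) in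
/-- The sum of the coefficients of an element of the periodic module. -/
noncomputable def coeffSum : (periodicModule k h N).carrier →+ N :=
  (Finsupp.liftAddHom fun _ => AddMonoidHom.id N : (ℤ →₀ N) →+ N)

theorem coeffSum_single (j : ℤ) (n : N) : coeffSum k h N (single k h j n) = n :=
  Finsupp.liftAddHom_apply_single _ _ _

theorem coeff_single_same (j : ℤ) (n : N) : coeff k h j (single k h j n) = n :=
  Finsupp.single_eq_same

theorem coeff_single_of_ne {i j : ℤ} (hij : i ≠ j) (n : N) :
    coeff k h j (single k h i n) = 0 :=
  Finsupp.single_eq_of_ne hij.symm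

theorem single_mem (j : ℤ) (n : N) : single k h j n ∈ (periodicModule k h N).deg j := ⟨n, rfl⟩

theorem exists_eq_single {j : ℤ} {z : (periodicModule k h N).carrier}
    (hz : z ∈ (periodicModule k h N).deg j) : ∃ n, single k h j n = z := hz

theorem induction_on {P : (periodicModule k h N).carrier → Prop}
    (z : (periodicModule k h N).carrier) (zero : P 0) (single : ∀ j n, P (single k h j n))
    (add : ∀ y z, P y → P z → P (y + z)) : P z :=
  Finsupp.induction_linear z zero add single

theorem ofPath_smul_of_not {a b : V} (p : Path a b)
    (hc : ¬ (IsCyclicVertex a ∧ IsCyclicVertex b)) (z : (periodicModule k h N).carrier) :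
    op (ofPath k ⟨a, b, p⟩) • z = 0 :=
  Periodic.ofPath_smul_of_not h p hc z

theorem cycleElt_smul_single (j : ℤ) (n : N) :
    op (cycleElt k V) • single k h j n = single k h (j + 1) n :=
  Periodic.cycleElt_smul_single h j n

theorem cycleElt_pow_smul_single (i : ℕ) (j : ℤ) (n : N) :
    op (cycleElt k V ^ i) • single k h j n = single k h (j + i) n :=
  Periodic.cycleElt_pow_smul_single h i j n

theorem rotate_smul_single (r : CyclicVertex V → k) (j : ℤ) (n : N) :
    op (rotate h j r) • single k h j n = single k h j (r • n) :=
  Periodic.rotate_smul_single h r j n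

end periodicModule

variable (k) in
/-- The homomorphism of periodic modules induced by a linear map. -/
noncomputable def periodicMap {N N' : Type w} [AddCommGroup N] [Module (CyclicVertex V → k) N]
    [AddCommGroup N'] [Module (CyclicVertex V → k) N'] (f : N →ₗ[CyclicVertex V → k] N') :
    periodicModule k h N ⟶ periodicModule k h N' where
  toLinearMap :=
    { toFun := Finsupp.mapRange.linearMap f
      map_add' := map_add (Finsupp.mapRange.linearMap f)
      map_smul' a z := LinearMap.congr_fun (mapRange_actHom h f a.unop) z }
  map_deg j _ hm := by
    obtain ⟨n, rfl⟩ := hm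
    exact ⟨f n, (Finsupp.mapRange_single (f := f) (hf := map_zero f)).symm⟩

@[simp]
theorem periodicMap_single {N N' : Type w} [AddCommGroup N] [Module (CyclicVertex V → k) N]
    [AddCommGroup N'] [Module (CyclicVertex V → k) N'] (f : N →ₗ[CyclicVertex V → k] N')
    (j : ℤ) (n : N) :
    GrModule.Hom.toLinearMap (periodicMap k h f) (periodicModule.single k h j n) =
      periodicModule.single k h j (f n) :=
  Finsupp.mapRange_single (f := f) (hf := map_zero f)

/-- The periodic module, as a functor. -/
noncomputable def periodicFunctor :
    ModuleCat.{w} (CyclicVertex V → k) ⥤ GrMod.{u, v, e, w} k V where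
  obj N := periodicModule k h N
  map f := periodicMap k h f.hom
  map_id N := GrModule.Hom.ext (LinearMap.ext fun z => by
    exact Finsupp.mapRange_id z)
  map_comp f g := GrModule.Hom.ext (LinearMap.ext fun z => by
    exact Finsupp.mapRange_comp _ (map_zero g.hom) _ (map_zero f.hom)
      (map_zero (g.hom ∘ₗ f.hom)) z)

/-! ### The stable fibre of a periodic module -/

variable (k N) in
/-- The sum of the coefficients, on the stable fibre of a periodic module. -/
noncomputable def coeffSumAdd : StableFibre h (periodicModule k h N) →+ N :=
  QuotientAddGroup.lift (stableRelations (periodicModule k h N)) (periodicModule.coeffSum k h N) (by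
    rintro _ ⟨y, rfl⟩
    rw [AddMonoidHom.mem_ker, AddMonoidHom.sub_apply, map_sub, sub_eq_zero, AddMonoidHom.id_apply,
      DistribSMul.toAddMonoidHom_apply]
    induction y using periodicModule.induction_on with
    | zero => rw [smul_zero]
    | single j n =>
      rw [periodicModule.cycleElt_smul_single, periodicModule.coeffSum_single,
        periodicModule.coeffSum_single]
    | add y z hy hz => rw [smul_add, map_add, map_add, hy, hz])

theorem coeffSumAdd_mk_single (j : ℤ) (n : N) :
    coeffSumAdd k h N (StableFibre.mk h _ (periodicModule.single k h j n)) = n :=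
  periodicModule.coeffSum_single h j n

theorem StableFibre.periodic_induction_on {P : StableFibre h (periodicModule k h N) → Prop}
    (z : StableFibre h (periodicModule k h N)) (zero : P 0)
    (single : ∀ j n, P (StableFibre.mk h (periodicModule k h N) (periodicModule.single k h j n)))
    (add : ∀ y z, P y → P z → P (y + z)) : P z := by
  induction z using StableFibre.induction_on with
  | zero => exact zero
  | homogeneous j m hm => obtain ⟨n, rfl⟩ := periodicModule.exists_eq_single h hm; exact single j n
  | add y z hy hz => exact add y z hy hz

theorem mk_single_eq_mk_single_zero (j : ℤ) (n : N) :
    StableFibre.mk h (periodicModule k h N) (periodicModule.single k h j n) =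
      StableFibre.mk h (periodicModule k h N) (periodicModule.single k h 0 n) := by
  have key (j : ℤ) : StableFibre.mk h (periodicModule k h N) (periodicModule.single k h (j + 1) n) =
      StableFibre.mk h (periodicModule k h N) (periodicModule.single k h j n) := by
    rw [← periodicModule.cycleElt_smul_single, StableFibre.mk_cycleElt_smul]
  induction j with
  | zero => rfl
  | succ j ih => rw [key, ih]
  | pred j ih => rw [← ih, ← key, sub_add_cancel]

variable (k N) in
/-- The stable fibre of the periodic module with components `N` is `N`. -/
noncomputable def periodicFibreEquiv :
    StableFibre h (periodicModule k h N) ≃ₗ[CyclicVertex V → k] N where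
  __ := coeffSumAdd k h N
  map_smul' r z := by
    change coeffSumAdd k h N (r • z) = r • coeffSumAdd k h N z
    induction z using StableFibre.periodic_induction_on with
    | zero => simp
    | single j n =>
      rw [StableFibre.smul_mk_of_mem r (periodicModule.single_mem h j n),
        periodicModule.rotate_smul_single, coeffSumAdd_mk_single, coeffSumAdd_mk_single]
    | add y z hy hz => simp only [smul_add, map_add, hy, hz]
  invFun n := StableFibre.mk h (periodicModule k h N) (periodicModule.single k h 0 n)
  left_inv z := by
    change StableFibre.mk h (periodicModule k h N) (periodicModule.single k h 0 (coeffSumAdd k h N z)) = z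
    induction z using StableFibre.periodic_induction_on with
    | zero => simp only [map_zero]
    | single j n => rw [coeffSumAdd_mk_single, mk_single_eq_mk_single_zero h j]
    | add y z hy hz => simp only [map_add, hy, hz]
  right_inv n := coeffSumAdd_mk_single h 0 n

/-- Taking the stable fibre is left inverse to forming periodic modules. -/
noncomputable def periodicFibreIso : periodicFunctor.{u, v, e, w} (k := k) h ⋙
    stableFibreFunctor h ≅ 𝟭 (ModuleCat.{w} (CyclicVertex V → k)) :=
  NatIso.ofComponents (fun N => (periodicFibreEquiv k h N).toModuleIso) fun {N N'} f => by
    ext z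
    change coeffSumAdd k h N' (StableFibre.map h (periodicMap k h f.hom) z) =
      f.hom (coeffSumAdd k h N z)
    induction z using StableFibre.periodic_induction_on with
    | zero => simp
    | single j n =>
      rw [coeffSumAdd_mk_single, StableFibre.map_mk, periodicMap_single, coeffSumAdd_mk_single]
    | add y z hy hz => simp only [map_add, hy, hz]

end PathAlgebra

/-! ### The part of a graded module without transient vertices -/

namespace PathAlgebra

open MulOpposite
open Quiver (Path)

variable {k : Type u} [Field k] {V : Type v} [Quiver.{e} V]

/-- A vertex is transient if it is not cyclic, but leads to a cyclic vertex. -/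
def IsTransient (a : V) : Prop :=
  ¬ IsCyclicVertex a ∧ ∃ c, ∃ _ : Path a c, IsCyclicVertex c

theorem isTransient_of_path (h : HasIsolatedCycles V) {a b : V} (p : Path a b)
    (hb : IsTransient b) : IsTransient a := by
  obtain ⟨hb, c, q, hc⟩ := hb
  exact ⟨fun ha => hb (h.isCyclicVertex_of_between p q ha hc), c, p.comp q, hc⟩

variable [Fintype V]

theorem isTransient_of_card_le_length {a b : V} (p : Path a b) (hp : Fintype.card V ≤ p.length)
    (ha : ¬ IsCyclicVertex a) : IsTransient a := by
  obtain ⟨c, q, _, hc⟩ := p.exists_isCyclicVertex hp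
  exact ⟨ha, c, q, hc⟩

/-- A long path has passed through a cyclic vertex, so a further path from its end to a cyclic
vertex would make that end cyclic. -/
theorem not_isTransient_of_card_le_length (h : HasIsolatedCycles V) {a b : V} (p : Path a b)
    (hp : Fintype.card V ≤ p.length) : ¬ IsTransient b := by
  rintro ⟨hb, c, q, hc⟩
  obtain ⟨x, _, r, hx⟩ := p.exists_isCyclicVertex hp
  exact hb (h.isCyclicVertex_of_between r q hx hc)

theorem smul_ofPath_eq_idem_mul {a b : V} (r : k) (p : Path a b) :
    r • ofPath k ⟨a, b, p⟩ = idem k a * (r • ofPath k ⟨a, b, p⟩) := by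
  rw [mul_smul_comm, idem_mul_ofPath]

theorem smul_ofPath_eq_mul_ofPath {a b : V} (r : k) (p : Path a b) :
    r • ofPath k ⟨a, b, p⟩ = (r • idem k a) * ofPath k ⟨a, b, p⟩ := by
  rw [smul_mul_assoc, idem_mul_ofPath]

theorem ofPath_mul_cycleElt_of_not {a b : V} (p : Path a b) (hb : ¬ IsCyclicVertex b) :
    ofPath k ⟨a, b, p⟩ * cycleElt k V = 0 := by
  rw [← ofPath_mul_idem, mul_assoc, idem_mul_cycleElt_of_not hb, mul_zero]

-- This splits the action of a path into the two operations understood on stable fibres and periodic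
-- modules: a twisted function in degree `j` and a power of `cycleElt`.
open Classical in
theorem smul_ofPath_eq_rotate_mul (h : HasIsolatedCycles V) {a b : V} (r : k) (p : Path a b)
    (ha : IsCyclicVertex a) (hb : IsCyclicVertex b) (j : ℤ) :
    r • ofPath k ⟨a, b, p⟩ =
      rotate h j (Pi.single ((h.perm ^ (-j)) ⟨a, ha⟩) r) * cycleElt k V ^ p.length := by
  have : rotate h j (Pi.single ((h.perm ^ (-j)) ⟨a, ha⟩) r) = r • idem k a := by
    rw [rotate, Finset.sum_eq_single ⟨a, ha⟩]
    · rw [Pi.single_eq_same]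
    · intro d _ hd
      rw [Pi.single_eq_of_ne fun h' => hd ((h.perm ^ (-j)).injective h'), zero_smul]
    · simp
  rw [this, smul_mul_assoc, ofPath_eq_idem_mul_cycleElt_pow h p ha hb]

theorem rotate_mul_idem_of_not (h : HasIsolatedCycles V) (j : ℤ) (r : CyclicVertex V → k) {a : V}
    (ha : ¬ IsCyclicVertex a) : rotate h j r * idem k a = 0 := by
  rw [rotate, Finset.sum_mul]
  refine Finset.sum_eq_zero fun c _ => ?_
  rw [smul_mul_assoc, idem_mul_idem_of_ne fun h' : c.1 = a => ha (h' ▸ c.2), smul_zero]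

theorem isTorsionModulo_of_forall_path {M : Type*} [AddCommGroup M]
    [Module (PathAlgebra k V)ᵐᵒᵖ M] {S : Submodule (PathAlgebra k V)ᵐᵒᵖ M} {m : M} (n : ℕ)
    (hm : ∀ {a b : V} (p : Path a b), n ≤ p.length → op (ofPath k ⟨a, b, p⟩) • m ∈ S) :
    IsTorsionModulo (grading k V) S m := by
  refine ⟨n, fun i hi a ha => ?_⟩
  induction ha using Submodule.span_induction with
  | zero => rw [op_zero, zero_smul]; exact zero_mem _
  | add x y _ _ hx hy => rw [MulOpposite.op_add, add_smul]; exact add_mem hx hy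
  | smul c x _ hx =>
    rw [← mul_one x, ← mul_smul_comm, op_mul, mul_smul]
    exact S.smul_mem _ hx
  | mem x hx =>
    obtain ⟨⟨a, b, p⟩, rfl, rfl⟩ := hx
    exact hm p hi

variable (h : HasIsolatedCycles V)

/-- The submodule of the elements without component at the transient vertices. -/
def coreSubmodule (M : GrMod.{u, v, e, w} k V) : Submodule (PathAlgebra k V)ᵐᵒᵖ M.carrier where
  carrier := {m | ∀ a : V, IsTransient a → op (idem k a) • m = 0}
  add_mem' hm hn a ha := by rw [smul_add, hm a ha, hn a ha, add_zero]
  zero_mem' a _ := smul_zero _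
  smul_mem' x m hm := by
    have key : ∀ (y : PathAlgebra k V) (a : V), IsTransient a →
        op (idem k a) • op y • m = 0 := by
      intro y a ha
      induction y using induction_on with
      | zero => rw [op_zero, zero_smul, smul_zero]
      | add y z hy hz => rw [MulOpposite.op_add, add_smul, smul_add, hy, hz, add_zero]
      | smul r p =>
        obtain ⟨b, c, p⟩ := p
        rw [smul_smul, ← op_mul]
        by_cases hc : c = a
        · subst hc
          -- A path ending at a transient vertex also starts at one, where `m` has no component.
          rw [smul_mul_assoc, ofPath_mul_idem, smul_ofPath_eq_idem_mul, op_mul, mul_smul,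
            hm b (isTransient_of_path h p ha), smul_zero]
        · rw [smul_mul_assoc, ofPath_mul_idem_of_ne p hc, smul_zero, op_zero, zero_smul]
    exact key x.unop

theorem proj_mem_coreSubmodule (M : GrMod.{u, v, e, w} k V) (m : M.carrier)
    (hm : m ∈ coreSubmodule h M) (j : ℤ) : M.proj j m ∈ coreSubmodule h M := fun a ha => by
  rw [← GrModule.proj_smul_zero (idem_mem_grading a), hm a ha, map_zero]

theorem map_mem_coreSubmodule {M N : GrMod.{u, v, e, w} k V} (f : M ⟶ N) (m : M.carrier)
    (hm : m ∈ coreSubmodule h M) : GrModule.Hom.toLinearMap f m ∈ coreSubmodule h N :=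
  fun a ha => by rw [← map_smul, hm a ha, map_zero]

/-- The graded submodule of the elements without component at the transient vertices. -/
noncomputable abbrev core (M : GrMod.{u, v, e, w} k V) : GrMod.{u, v, e, w} k V :=
  M.ofSubmodule (coreSubmodule h M) (proj_mem_coreSubmodule h M)

/-- The inclusion of the core in the graded module. -/
noncomputable abbrev coreInclApp (M : GrMod.{u, v, e, w} k V) : core h M ⟶ M :=
  GrModule.ofSubmodule.incl (proj_mem_coreSubmodule h M)

/-- The core of a graded module, as a functor. -/
noncomputable def coreFunctor : GrMod.{u, v, e, w} k V ⥤ GrMod.{u, v, e, w} k V where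
  obj := core h
  map f := GrModule.ofSubmodule.map _ _ f (map_mem_coreSubmodule h f)
  map_id _ := rfl
  map_comp _ _ := rfl

variable (k) in
/-- The inclusion of the core. -/
noncomputable def coreIncl : coreFunctor.{u, v, e, w} (k := k) h ⟶ 𝟭 _ where
  app := coreInclApp h
  naturality _ _ _ := rfl

/-- No path with at least `|V|` arrows ends at a transient vertex, so such paths carry all of `M`
into the core. -/
theorem torsionIso_coreIncl (M : GrMod.{u, v, e, w} k V) :
    torsionIso (grading k V) (coreInclApp h M) := by
  refine ⟨isTorsionModule_submodule_iff.2 fun m hm => ?_,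
    isTorsionModule_quotient_iff.2 fun m => ?_⟩
  · rw [(injective_iff_map_eq_zero _).1 (GrModule.ofSubmodule.incl_injective
      (proj_mem_coreSubmodule h M)) m hm]
    exact .zero _
  · rw [show LinearMap.range (GrModule.Hom.toLinearMap (coreInclApp h M)) =
      coreSubmodule h M from GrModule.ofSubmodule.range_incl _]
    refine isTorsionModulo_of_forall_path (Fintype.card V) fun {b c} p hp a ha => ?_
    rw [smul_smul, ← op_mul, ofPath_mul_idem_of_ne p, op_zero, zero_smul]
    rintro rfl
    exact not_isTransient_of_card_le_length h p hp ha

/-! ### Comparison of the core with the periodic module on the stable fibre -/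

/-- The additive map sending a homogeneous element to its class in the stable fibre. -/
noncomputable def toPeriodic (M : GrMod.{u, v, e, w} k V) :
    M.carrier →+ (periodicModule k h (StableFibre h M)).carrier :=
  M.gradedLift fun j => (periodicModule.single k h j).comp (StableFibre.mk h M)

theorem toPeriodic_of_mem {M : GrMod.{u, v, e, w} k V} {j : ℤ} {m : M.carrier}
    (hm : m ∈ M.deg j) : toPeriodic h M m = periodicModule.single k h j (StableFibre.mk h M m) :=
  GrModule.gradedLift_of_mem _ hm

theorem coeff_toPeriodic {M : GrMod.{u, v, e, w} k V} (j : ℤ) (m : M.carrier) :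
    periodicModule.coeff k h j (toPeriodic h M m) = StableFibre.mk h M (M.proj j m) := by
  induction m using M.induction_on with
  | zero => simp only [map_zero]
  | homogeneous i m hm =>
    rw [toPeriodic_of_mem h hm]
    by_cases hij : i = j
    · subst hij
      rw [periodicModule.coeff_single_same, GrModule.proj_of_mem hm]
    · rw [periodicModule.coeff_single_of_ne h hij, GrModule.proj_of_mem_of_ne hm (Ne.symm hij),
        map_zero]
  | add m n hm hn => simp only [map_add, hm, hn]

/-- Paths with a non-cyclic end act by zero on the periodic module, so `m p` must have zero class.
If the target is not cyclic, `m p` is killed by `cycleElt`; if only the source is not, it is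
transient and `m` lies in the core. -/
theorem toPeriodic_smul_of_mem {M : GrMod.{u, v, e, w} k V} (x : PathAlgebra k V) {j : ℤ}
    {m : M.carrier} (hm : m ∈ M.deg j) (hc : m ∈ coreSubmodule h M) :
    toPeriodic h M (op x • m) = op x • toPeriodic h M m := by
  classical
  induction x using induction_on with
  | zero => simp only [op_zero, zero_smul, map_zero]
  | add x y hx hy => rw [MulOpposite.op_add, add_smul, add_smul, map_add, hx, hy]
  | smul r p =>
    obtain ⟨a, b, p⟩ := p
    have hdeg : op (r • ofPath k ⟨a, b, p⟩) • m ∈ M.deg (j + p.length) :=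
      M.smul_mem (Submodule.smul_mem _ _ (ofPath_mem_grading ⟨a, b, p⟩)) hm
    rw [toPeriodic_of_mem h hdeg, toPeriodic_of_mem h hm]
    by_cases hab : IsCyclicVertex a ∧ IsCyclicVertex b
    · rw [smul_ofPath_eq_rotate_mul h r p hab.1 hab.2 j, op_mul, mul_smul, mul_smul,
        StableFibre.mk_cycleElt_pow_smul, periodicModule.rotate_smul_single,
        periodicModule.cycleElt_pow_smul_single, StableFibre.smul_mk_of_mem _ hm]
    · have hr : op (r • ofPath k ⟨a, b, p⟩) •
          periodicModule.single k h j (StableFibre.mk h M m) = 0 := by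
        rw [smul_ofPath_eq_mul_ofPath, op_mul, mul_smul, periodicModule.ofPath_smul_of_not h p hab]
      have hl : StableFibre.mk h M (op (r • ofPath k ⟨a, b, p⟩) • m) = 0 := by
        by_cases hb : IsCyclicVertex b
        · have ha : IsTransient a := ⟨fun ha => hab ⟨ha, hb⟩, b, p, hb⟩
          rw [smul_ofPath_eq_idem_mul, op_mul, mul_smul, hc a ha, smul_zero, map_zero]
        · apply StableFibre.mk_eq_zero_of_cycleElt_smul
          rw [smul_smul, ← op_mul, smul_mul_assoc, ofPath_mul_cycleElt_of_not p hb, smul_zero,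
            op_zero, zero_smul]
      rw [hr, hl, map_zero]

theorem toPeriodic_smul {M : GrMod.{u, v, e, w} k V} (x : PathAlgebra k V) {m : M.carrier}
    (hc : m ∈ coreSubmodule h M) : toPeriodic h M (op x • m) = op x • toPeriodic h M m := by
  obtain ⟨s, hs⟩ := M.exists_support m
  rw [← GrModule.sum_proj hs, Finset.smul_sum, map_sum, map_sum, Finset.smul_sum]
  exact Finset.sum_congr rfl fun j _ => toPeriodic_smul_of_mem h x (GrModule.proj_mem j m)
    (proj_mem_coreSubmodule h M m hc j)

theorem toPeriodic_naturality {M N : GrMod.{u, v, e, w} k V} (f : M ⟶ N) (m : M.carrier) :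
    toPeriodic h N (GrModule.Hom.toLinearMap f m) =
      GrModule.Hom.toLinearMap (periodicMap k h (StableFibre.map h f)) (toPeriodic h M m) := by
  induction m using M.induction_on with
  | zero => simp only [map_zero]
  | homogeneous j m hm =>
    rw [toPeriodic_of_mem h hm, toPeriodic_of_mem h (GrModule.Hom.map_deg f _ _ hm),
      periodicMap_single, StableFibre.map_mk]
  | add m n hm hn => simp only [map_add, hm, hn]

/-- The homomorphism from the core to the periodic module on the stable fibre. -/
noncomputable def coreToPeriodicApp (M : GrMod.{u, v, e, w} k V) :
    core h M ⟶ periodicModule k h (StableFibre h M) where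
  toLinearMap :=
    { toFun m := toPeriodic h M (GrModule.Hom.toLinearMap (coreInclApp h M) m)
      map_add' m n := by rw [map_add]; exact map_add _ _ _
      map_smul' x m := by
        rw [map_smul]
        exact toPeriodic_smul h x.unop (GrModule.ofSubmodule.incl_mem _ m) }
  map_deg j m hm := by
    change toPeriodic h M (GrModule.Hom.toLinearMap (coreInclApp h M) m) ∈ _
    rw [toPeriodic_of_mem h (GrModule.Hom.map_deg (coreInclApp h M) j m hm)]
    exact periodicModule.single_mem h j _

theorem coreToPeriodicApp_apply (M : GrMod.{u, v, e, w} k V)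
    (m : (core h M).carrier) :
    GrModule.Hom.toLinearMap (coreToPeriodicApp h M) m =
      toPeriodic h M (GrModule.Hom.toLinearMap (coreInclApp h M) m) := rfl

variable (k) in
/-- The natural transformation from the core to the periodic module on the stable fibre. -/
noncomputable def coreToPeriodic :
    coreFunctor.{u, v, e, w} (k := k) h ⟶ stableFibreFunctor h ⋙ periodicFunctor h where
  app := coreToPeriodicApp h
  naturality _ _ f := GrModule.Hom.ext (LinearMap.ext fun m => toPeriodic_naturality h f m.1)

/-- A long path from a cyclic vertex begins with `e_a xⁿ = xⁿ e_(σⁿ a)`, which kills `m`. The `|V|`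
extra arrows ensure that its first `n` arrows end at a cyclic vertex. A long path from a non-cyclic
vertex starts at a transient one. -/
theorem isTorsionModulo_bot_of_pow_smul {M : GrMod.{u, v, e, w} k V} {m : M.carrier} {n : ℕ}
    (hn : op (cycleElt k V ^ n) • m = 0) (hc : m ∈ coreSubmodule h M) :
    IsTorsionModulo (grading k V) ⊥ m := by
  refine isTorsionModulo_of_forall_path (n + Fintype.card V) fun {a b} p hp => ?_
  rw [Submodule.mem_bot]
  by_cases ha : IsCyclicVertex a
  · obtain ⟨c, q, r, rfl, hq⟩ := p.exists_eq_comp_of_le_length (n := n) (by omega)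
    rw [Path.length_comp] at hp
    obtain ⟨d, r', _, hd⟩ := r.exists_isCyclicVertex (by omega)
    rw [← ofPath_mul_ofPath_of_eq, ofPath_eq_idem_mul_cycleElt_pow h q ha
      (h.isCyclicVertex_of_between q r' ha hd), hq, idem_mul_cycleElt_pow h ⟨a, ha⟩ n, mul_assoc,
      op_mul, mul_smul, hn, smul_zero]
  · rw [← idem_mul_ofPath, op_mul, mul_smul,
      hc a (isTransient_of_card_le_length p (by omega) ha), smul_zero]

theorem single_mem_range_coreToPeriodic {M : GrMod.{u, v, e, w} k V} {j : ℤ} {m : M.carrier}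
    (hm : m ∈ M.deg j) : periodicModule.single k h j (StableFibre.mk h M m) ∈
      LinearMap.range (GrModule.Hom.toLinearMap (coreToPeriodicApp h M)) := by
  -- `m` may lie outside the core; its part at the cyclic vertices lies inside and has the same
  -- class.
  have hcore : op (rotate h j (1 : CyclicVertex V → k)) • m ∈ coreSubmodule h M := fun a ha => by
    rw [smul_smul, ← op_mul, rotate_mul_idem_of_not h j _ ha.1, op_zero, zero_smul]
  obtain ⟨y, -, hy⟩ := GrModule.ofSubmodule.exists_incl_eq (proj_mem_coreSubmodule h M)
    (StableFibre.rotate_smul_mem (h := h) 1 hm) hcore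
  refine ⟨y, ?_⟩
  rw [coreToPeriodicApp_apply]
  refine (congrArg (toPeriodic h M) hy).trans ?_
  rw [toPeriodic_of_mem h (StableFibre.rotate_smul_mem (h := h) 1 hm),
    ← StableFibre.smul_mk_of_mem _ hm, one_smul]

theorem torsionIso_coreToPeriodic (M : GrMod.{u, v, e, w} k V) :
    torsionIso (grading k V) (coreToPeriodicApp h M) := by
  classical
  refine ⟨isTorsionModule_submodule_iff.2 fun m hm => ?_,
    isTorsionModule_quotient_iff.2 fun z => ?_⟩
  · set i := GrModule.Hom.toLinearMap (coreInclApp h M) with hi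
    have hinj : Function.Injective i :=
      GrModule.ofSubmodule.incl_injective (proj_mem_coreSubmodule h M)
    have hcore : i m ∈ coreSubmodule h M := GrModule.ofSubmodule.incl_mem _ m
    rw [LinearMap.mem_ker, coreToPeriodicApp_apply] at hm
    obtain ⟨s, hs⟩ := M.exists_support (i m)
    have htors : IsTorsionModulo (grading k V) ⊥ (i m) := by
      rw [← GrModule.sum_proj hs]
      refine IsTorsionModulo.sum s fun j _ => ?_
      have h0 := coeff_toPeriodic h j (i m)
      rw [hm, map_zero] at h0
      obtain ⟨n, hn⟩ := StableFibre.exists_pow_smul_eq_zero (GrModule.proj_mem j (i m)) h0.symm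
      -- Each homogeneous component of an element of the kernel has zero class, hence is killed by a
      -- power of `cycleElt`.
      exact isTorsionModulo_bot_of_pow_smul h hn (proj_mem_coreSubmodule h M _ hcore j)
    obtain ⟨n, hn⟩ := htors
    refine ⟨n, fun l hl x hx => (Submodule.mem_bot _).2 (hinj ?_)⟩
    rw [map_zero, map_smul]
    exact (Submodule.mem_bot _).1 (hn l hl x hx)
  · induction z using periodicModule.induction_on with
    | zero => exact .zero _
    | add y z hy hz => exact hy.add hz
    | single j z =>
      obtain ⟨l, hl⟩ := StableFibre.exists_mk_eq z
      -- Paths of this length lead from degree `j` to degrees at least `l`, where `z` has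
      -- homogeneous representatives.
      refine isTorsionModulo_of_forall_path (l - j).toNat fun {a b} p hp => ?_
      by_cases hab : IsCyclicVertex a ∧ IsCyclicVertex b
      · obtain ⟨m, hm, rfl⟩ := hl (j + p.length) (by omega)
        rw [← one_smul k (ofPath k ⟨a, b, p⟩), smul_ofPath_eq_rotate_mul h 1 p hab.1 hab.2 j,
          op_mul, mul_smul, periodicModule.rotate_smul_single,
          periodicModule.cycleElt_pow_smul_single, ← periodicModule.rotate_smul_single]
        exact Submodule.smul_mem _ _ (single_mem_range_coreToPeriodic h hm)
      · rw [periodicModule.ofPath_smul_of_not h p hab]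
        exact zero_mem _

include h in
/-- The quotient category of graded modules by torsion modules is equivalent to the category of
modules over the ring of functions on the cyclic vertices. -/
theorem nonempty_qGr_equivalence :
    Nonempty (QGr.{u, max u v e, w} (grading k V) ≌ ModuleCat.{w} (CyclicVertex V → k)) :=
  (torsionIso (grading k V)).nonempty_localization_equivalence (stableFibreFunctor h)
    (periodicFunctor h) (coreFunctor h) (stableFibreFunctor_inverts h) (periodicFibreIso h)
    (coreIncl k h) (coreToPeriodic k h) (torsionIso_coreIncl h) (torsionIso_coreToPeriodic h)

end PathAlgebra

theorem corollary10p5 (k : Type u) [Field k] (V : Type v) [Quiver.{e} V] [Fintype V]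
    [∀ a b : V, Finite (a ⟶ b)]
    (hN : IsNoetherianRing (PathAlgebra k V) ∨ IsNoetherianRing (PathAlgebra k V)ᵐᵒᵖ) :
    (¬ Module.Finite k (PathAlgebra k V) → gkDim k (PathAlgebra k V) = 1) ∧
    Nonempty (QGr.{u, max u v e, max u v e} (PathAlgebra.grading k V) ≌
      ModuleCat.{max u v e} (Fin (Nat.card {x : V // IsCyclicVertex x}) → k)) := by
  have h := PathAlgebra.hasIsolatedCycles_of_isNoetherianRing hN
  refine ⟨fun hfin => le_antisymm (PathAlgebra.gkDim_le_one h) (PathAlgebra.one_le_gkDim hfin), ?_⟩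
  obtain ⟨E⟩ := PathAlgebra.nonempty_qGr_equivalence.{u, v, e, max u v e} (k := k) h
  -- Numbering the cyclic vertices identifies their ring of functions with `kⁿ`.
  let φ := RingEquiv.piCongrLeft (fun _ => k) (Finite.equivFin (CyclicVertex V))
  exact ⟨E.trans (ModuleCat.restrictScalarsEquivalenceOfRingEquiv φ).symm⟩
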